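/- Let $\mathcal H$ be a complex Hilbert space (not necessarily separable), let $\mathcal R$ be a set of pairwise commuting self-adjoint bounded operators on $\mathcal H$, and let $K$ be a positive operator on $\mathcal H$ of trace $1$, with associated normal state $\rho_K(A)=\operatorname{Tr}(KA)$ of $\mathfrak L(\mathcal H)$. Definitions. "Subalgebra" means unital $C^*$-subalgebra. A state $\omega$ of a unital $C^*$-algebra $\mathcal B$ is dispersion-free if $\omega(AX)=\omega(A)\omega(X)$ for all $A,X\in\mathcal B$. A subalgebra $\mathcal B\subseteq\mathfrak L(\mathcal H)$ is beable for a state $\rho$ of $\mathfrak L(\mathcal H)$ if there is a Borel probability measure $\mu$ on the space of dispersion-free states of $\mathcal B$ (with the weak-$*$ topology) such that $\rho(A)=\int\omega(A)\,d\mu(\omega)$ for all $A\in\mathcal B$. It is $\mathcal R$-beable for $\rho$ if it is beable for $\rho$, $\mathcal R\subseteq\mathcal B$, and $U\mathcal BU^*=\mathcal B$ for every unitary $U\in\mathcal R'$ such that $\rho(U^*AU)=\rho(A)$ for all $A\in\mathfrak L(\mathcal H)$. It is maximal $\mathcal R$-beable for $\rho$ if it is maximal under inclusion among the $\mathcal R$-beable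 subalgebras for $\rho$; "for $K$" means "for $\rho_K$". Write $[\,\cdot\,]$ for closed linear span, $P_{\mathcal S}$ for the orthogonal projection onto a closed subspace $\mathcal S$, $P_v=P_{[v]}$, and $\mathrm{vN}(\cdot)$ for the von Neumann algebra generated by a set of operators. For a set $\mathcal N$ of operators let $\mathfrak L(\mathcal S^\perp)\oplus \mathcal N P_{\mathcal S}=\{(I-P_{\mathcal S})X(I-P_{\mathcal S})+AP_{\mathcal S}: X\in\mathfrak L(\mathcal H),\ A\in\mathcal N\}$. (i) If $K\in\mathcal R'$, let $\mathcal S=[\mathcal R''\,\overline{\operatorname{ran}K}]$. Then $\mathfrak L(\mathcal S^\perp)\oplus \mathrm{vN}(\mathcal R,K)P_{\mathcal S}$ is a maximal $\mathcal R$-beable algebra for $K$, and it is the only one. (ii) If $K=P_v$ for some $v\in\mathcal H$, let $\mathcal S=[\mathcal R''v]$. Then $\mathfrak L(\mathcal S^\perp)\oplus \mathrm{vN}(\mathcal R)P_{\mathcal S}$ is a maximal $\mathcal R$-beable algebra for $K$, and it is the only one. -/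

import Mathlib

open scoped ComplexOrder InnerProductSpace

/-! ### States, dispersion-free states, beable subalgebras -/

section AbstractAlgebra

/-- The states of a unital `C⋆`-algebra `A`: the (continuous) linear functionals `ω` that are positive
and normalised, `ω 1 = 1`.  They are viewed inside the weak-`*` dual. -/
def stateSpace (A : Type*) [NormedRing A] [StarRing A] [NormedAlgebra ℂ A] :
    Set (WeakDual ℂ A) :=
  {ω | (∀ a : A, 0 ≤ ω (star a * a)) ∧ ω 1 = 1}

/-- The definite algebra `D_ω` of a functional `ω`. -/
def definiteAlgebra {A : Type*} [NormedRing A] [NormedAlgebra ℂ A] (ω : WeakDual ℂ A) : Set A :=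
  {a | ∀ x : A, ω (a * x) = ω a * ω x}

/-- The dispersion-free states of `A`: those states whose definite algebra is all of `A`. -/
def dispersionFreeStates (A : Type*) [NormedRing A] [StarRing A] [NormedAlgebra ℂ A] :
    Set (WeakDual ℂ A) :=
  {ω | ω ∈ stateSpace A ∧ ∀ a : A, a ∈ definiteAlgebra ω}

/-- The space of dispersion-free states carries the Borel `σ`-algebra of the weak-`*` topology. -/
noncomputable instance dispersionFreeStates.instMeasurableSpace
    (A : Type*) [NormedRing A] [StarRing A] [NormedAlgebra ℂ A] :
    MeasurableSpace (dispersionFreeStates A) :=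
  borel _

instance dispersionFreeStates.instBorelSpace
    (A : Type*) [NormedRing A] [StarRing A] [NormedAlgebra ℂ A] :
    BorelSpace (dispersionFreeStates A) :=
  ⟨rfl⟩

/-- The unital `C⋆`-subalgebra `B` of `A` (a norm-closed unital star-subalgebra) is beable for the
state `ρ` of `A`: the restriction of `ρ` to `B` is a mixture of dispersion-free states of `B`. -/
def IsBeable {A : Type*} [CStarAlgebra A] (ρ : stateSpace A) (B : StarSubalgebra ℂ A) : Prop :=
  IsClosed (B : Set A) ∧
    ∃ μ : MeasureTheory.Measure (dispersionFreeStates B),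
      MeasureTheory.IsProbabilityMeasure μ ∧
        ∀ b : B, (ρ : WeakDual ℂ A) (b : A) =
          ∫ ω : dispersionFreeStates B, (ω : WeakDual ℂ B) b ∂μ

/-- `B` is `R`-beable for the state `ρ`: it is beable for `ρ`, it contains `R`, and it is mapped onto
itself by every spatial automorphism `X ↦ U X U⋆`, with `U` a unitary of `A`, that fixes both `R` and
`ρ`. -/
structure IsRBeable {A : Type*} [CStarAlgebra A] (R : Set A) (ρ : stateSpace A)
    (B : StarSubalgebra ℂ A) : Prop where
  beable : IsBeable ρ B
  priv : R ⊆ (B : Set A)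
  definable : ∀ U ∈ unitary A, U ∈ Set.centralizer R →
    (∀ X : A, (ρ : WeakDual ℂ A) (star U * X * U) = (ρ : WeakDual ℂ A) X) →
      (fun X : A => U * X * star U) '' (B : Set A) = (B : Set A)

/-- `B` is maximal, with respect to inclusion, among the `R`-beable subalgebras for `ρ`. -/
def IsMaximalRBeable {A : Type*} [CStarAlgebra A] (R : Set A) (ρ : stateSpace A)
    (B : StarSubalgebra ℂ A) : Prop :=
  Maximal (IsRBeable R ρ) B

end AbstractAlgebra

/-! ### Normal states of `L(H)` -/

section NormalStates

variable {H : Type*} [NormedAddCommGroup H] [InnerProductSpace ℂ H] [CompleteSpace H]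

/-- The trace of an operator, computed in some Hilbert basis of `H` (for trace-class operators it does
not depend on the basis, see `IsDensityOperator.hasSum_inner`). -/
noncomputable def opTrace (T : H →L[ℂ] H) : ℂ :=
  ∑' i, ⟪(exists_hilbertBasis ℂ H).choose_spec.choose i,
    T ((exists_hilbertBasis ℂ H).choose_spec.choose i)⟫_ℂ

/-- Positive operators of trace one. A positive operator whose diagonal is not summable has
`opTrace` equal to `0`, so it is excluded. -/
def IsDensityOperator (K : H →L[ℂ] H) : Prop :=
  K.IsPositive ∧ opTrace K = 1

/-- Traces of `Q ∘ Q ∘ A`, for `Q` a self-adjoint operator that is square-summable on some Hilbert basis `c`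
(a Hilbert–Schmidt operator), can be computed in any Hilbert basis `b`. -/
theorem hasSum_inner_of_summable_sq {ι κ : Type*} (b : HilbertBasis ι ℂ H) (c : HilbertBasis κ ℂ H)
    (Q A : H →L[ℂ] H) (hQ : ∀ x y, ⟪Q x, y⟫_ℂ = ⟪x, Q y⟫_ℂ)
    (hs : Summable fun j => ‖Q (c j)‖ ^ 2) :
    HasSum (fun i => ⟪b i, Q (Q (A (b i)))⟫_ℂ) (∑' j, ⟪Q (c j), A (Q (c j))⟫_ℂ) := by
  have parseval : ∀ x : H, HasSum (fun i => ‖⟪b i, x⟫_ℂ‖ ^ 2) (‖x‖ ^ 2) := by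
    intro x
    have h := b.hasSum_inner_mul_inner x x
    have e : (fun i => ⟪x, b i⟫_ℂ * ⟪b i, x⟫_ℂ) = fun i => ((‖⟪b i, x⟫_ℂ‖ ^ 2 : ℝ) : ℂ) := by
      funext i
      rw [← inner_conj_symm x (b i), Complex.conj_mul']
      push_cast; rfl
    have e' : ⟪x, x⟫_ℂ = ((‖x‖ ^ 2 : ℝ) : ℂ) := by
      rw [inner_self_eq_norm_sq_to_K]; push_cast; rfl
    rw [e, e'] at h
    exact Complex.hasSum_ofReal.1 h
  have sumx : ∀ f : κ → H, (Summable fun j => ‖f j‖ ^ 2) →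
      Summable fun p : κ × ι => ‖⟪b p.2, f p.1⟫_ℂ‖ ^ 2 := by
    intro f hf
    rw [summable_prod_of_nonneg (fun _ => by positivity)]
    refine ⟨fun j => (parseval (f j)).summable, ?_⟩
    simpa only [(parseval (f _)).tsum_eq] using hf
  have hA : Summable fun j => ‖(star A) (Q (c j))‖ ^ 2 := by
    refine Summable.of_nonneg_of_le (fun _ => by positivity) (fun j => ?_)
      (hs.mul_left (‖star A‖ ^ 2))
    rw [← mul_pow]
    gcongr
    exact (star A).le_opNorm _
  have hF : Summable fun p : κ × ι => ⟪(star A) (Q (c p.1)), b p.2⟫_ℂ * ⟪b p.2, Q (c p.1)⟫_ℂ := by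
    refine Summable.of_norm_bounded ((sumx _ hA).add (sumx _ hs)) (fun p => ?_)
    rw [norm_mul, norm_inner_symm]
    nlinarith [sq_nonneg (‖⟪b p.2, (star A) (Q (c p.1))⟫_ℂ‖ - ‖⟪b p.2, Q (c p.1)⟫_ℂ‖),
      sq_nonneg (‖⟪b p.2, (star A) (Q (c p.1))⟫_ℂ‖), sq_nonneg (‖⟪b p.2, Q (c p.1)⟫_ℂ‖)]
  have h1 : ∀ j, HasSum (fun i => ⟪(star A) (Q (c j)), b i⟫_ℂ * ⟪b i, Q (c j)⟫_ℂ)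
      ⟪Q (c j), A (Q (c j))⟫_ℂ := by
    intro j
    have h := b.hasSum_inner_mul_inner ((star A) (Q (c j))) (Q (c j))
    rwa [ContinuousLinearMap.star_eq_adjoint, ContinuousLinearMap.adjoint_inner_left] at h
  have h2 : ∀ i, HasSum (fun j => ⟪(star A) (Q (c j)), b i⟫_ℂ * ⟪b i, Q (c j)⟫_ℂ)
      ⟪b i, Q (Q (A (b i)))⟫_ℂ := by
    intro i
    have h := c.hasSum_inner_mul_inner (Q (b i)) (Q (A (b i)))
    rw [hQ] at h
    refine Eq.subst (motive := fun f => HasSum f ⟪b i, Q (Q (A (b i)))⟫_ℂ) ?_ h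
    funext j
    symm
    rw [ContinuousLinearMap.star_eq_adjoint, ContinuousLinearMap.adjoint_inner_left, hQ, hQ, mul_comm]
  have h3 := hF.hasSum.prod_fiberwise h1
  have h4 := ((Equiv.prodComm ι κ).hasSum_iff.2 hF.hasSum).prod_fiberwise h2
  rw [h3.tsum_eq]
  exact h4

theorem IsDensityOperator.exists_sqrt {K : H →L[ℂ] H} (hK : IsDensityOperator K) :
    ∃ Q : H →L[ℂ] H, (∀ x y, ⟪Q x, y⟫_ℂ = ⟪x, Q y⟫_ℂ) ∧ (∀ x, K x = Q (Q x)) ∧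
      HasSum (fun j => ‖Q ((exists_hilbertBasis ℂ H).choose_spec.choose j)‖ ^ 2) 1 := by
  have h0 : 0 ≤ K := (ContinuousLinearMap.nonneg_iff_isPositive K).2 hK.1
  have hsq := CFC.sqrt_mul_sqrt_self K h0
  have hpos := (ContinuousLinearMap.nonneg_iff_isPositive _).1 (CFC.sqrt_nonneg K)
  refine ⟨CFC.sqrt K, fun x y => hpos.isSymmetric x y,
    fun x => (congrArg (fun T : H →L[ℂ] H => T x) hsq).symm, ?_⟩
  have ht := hK.2
  unfold opTrace at ht
  have hsum : Summable fun i => ⟪(exists_hilbertBasis ℂ H).choose_spec.choose i,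
      K ((exists_hilbertBasis ℂ H).choose_spec.choose i)⟫_ℂ := by
    by_contra h
    rw [tsum_eq_zero_of_not_summable h] at ht
    exact zero_ne_one ht
  have h1 := hsum.hasSum
  rw [ht] at h1
  have e : ∀ x : H, ⟪x, K x⟫_ℂ = ((‖(CFC.sqrt K) x‖ ^ 2 : ℝ) : ℂ) := by
    intro x
    rw [show K x = CFC.sqrt K (CFC.sqrt K x) from
      (congrArg (fun T : H →L[ℂ] H => T x) hsq).symm]
    refine (hpos.isSymmetric x (CFC.sqrt K x)).symm.trans ?_
    refine (inner_self_eq_norm_sq_to_K (𝕜 := ℂ) (CFC.sqrt K x)).trans ?_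
    push_cast; rfl
  simp only [e] at h1
  rw [← Complex.hasSum_ofReal]
  simpa using h1

/-- For a density operator `K`, the trace of `K A` is an unconditionally convergent sum with the same
value in every Hilbert basis. -/
theorem IsDensityOperator.hasSum_inner {K : H →L[ℂ] H} (hK : IsDensityOperator K)
    {ι : Type*} (b : HilbertBasis ι ℂ H) (A : H →L[ℂ] H) :
    HasSum (fun i => ⟪b i, (K * A) (b i)⟫_ℂ) (opTrace (K * A)) := by
  obtain ⟨Q, hQ, hKQ, hs⟩ := hK.exists_sqrt
  unfold opTrace
  simp only [mul_apply_eq_comp, hKQ]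
  rw [(hasSum_inner_of_summable_sq _ _ Q A hQ hs.summable).tsum_eq]
  exact hasSum_inner_of_summable_sq b _ Q A hQ hs.summable

theorem IsDensityOperator.exists_sandwich {K : H →L[ℂ] H} (hK : IsDensityOperator K) :
    ∃ (κ : Set H) (x : κ → H), HasSum (fun j => ‖x j‖ ^ 2) 1 ∧
      ∀ A : H →L[ℂ] H, HasSum (fun j => ⟪x j, A (x j)⟫_ℂ) (opTrace (K * A)) := by
  obtain ⟨Q, hQ, hKQ, hs⟩ := hK.exists_sqrt
  refine ⟨_, _, hs, fun A => ?_⟩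
  have hsum : Summable fun j => ⟪Q ((exists_hilbertBasis ℂ H).choose_spec.choose j),
      A (Q ((exists_hilbertBasis ℂ H).choose_spec.choose j))⟫_ℂ := by
    refine Summable.of_norm_bounded (hs.summable.mul_left ‖A‖) (fun j => ?_)
    refine (norm_inner_le_norm _ _).trans ?_
    rw [sq, mul_left_comm]
    gcongr
    exact A.le_opNorm _
  convert hsum.hasSum using 1
  unfold opTrace
  simp only [mul_apply_eq_comp, hKQ]
  exact (hasSum_inner_of_summable_sq _ _ Q A hQ hs.summable).tsum_eq

/-- The functional `A ↦ Tr (K A)` of a density operator `K`. -/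
noncomputable def traceFunctional (K : H →L[ℂ] H) (hK : IsDensityOperator K) :
    WeakDual ℂ (H →L[ℂ] H) :=
  StrongDual.toWeakDual <| LinearMap.mkContinuous
    { toFun := fun A => opTrace (K * A)
      map_add' := fun A B => by
        obtain ⟨κ, x, -, h⟩ := hK.exists_sandwich
        refine (h (A + B)).unique ?_
        simpa [inner_add_right] using (h A).add (h B)
      map_smul' := fun z A => by
        obtain ⟨κ, x, -, h⟩ := hK.exists_sandwich
        refine (h (z • A)).unique ?_
        simpa [inner_smul_right] using (h A).mul_left z }
    1 (fun A => by
      obtain ⟨κ, x, hx, h⟩ := hK.exists_sandwich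
      change ‖opTrace (K * A)‖ ≤ 1 * ‖A‖
      rw [← (h A).tsum_eq]
      refine tsum_of_norm_bounded (hx.mul_right ‖A‖) (fun j => ?_)
      refine (norm_inner_le_norm _ _).trans ?_
      rw [sq, mul_assoc, mul_comm (‖x j‖) ‖A‖]
      gcongr
      exact A.le_opNorm _)

theorem traceFunctional_apply (K : H →L[ℂ] H) (hK : IsDensityOperator K) (A : H →L[ℂ] H) :
    traceFunctional K hK A = opTrace (K * A) :=
  rfl

theorem traceFunctional_mem_stateSpace (K : H →L[ℂ] H) (hK : IsDensityOperator K) :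
    traceFunctional K hK ∈ stateSpace (H →L[ℂ] H) := by
  obtain ⟨κ, x, -, h⟩ := hK.exists_sandwich
  refine ⟨fun A => ?_, ?_⟩
  · rw [traceFunctional_apply]
    refine (h _).nonneg (fun j => ?_)
    rw [mul_apply_eq_comp, ContinuousLinearMap.star_eq_adjoint,
      ContinuousLinearMap.adjoint_inner_right]
    rw [inner_self_eq_norm_sq_to_K]
    change (0 : ℂ) ≤ ((‖A (x j)‖ : ℝ) : ℂ) ^ 2
    rw [← Complex.ofReal_pow]
    exact Complex.zero_le_real.2 (sq_nonneg _)
  · rw [traceFunctional_apply, mul_one, hK.2]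

/-- The normal state `A ↦ Tr (K A)` of `L(H)` defined by a positive trace-one operator `K`. -/
noncomputable def normalState (K : H →L[ℂ] H) (hK : IsDensityOperator K) :
    stateSpace (H →L[ℂ] H) :=
  ⟨traceFunctional K hK, traceFunctional_mem_stateSpace K hK⟩

/-! ### Generated von Neumann algebras, cyclic subspaces, direct sums -/

/-- `vN(R)`: the smallest von Neumann algebra on `H` that contains `R` (as a set of operators). -/
def vonNeumannGenerated (R : Set (H →L[ℂ] H)) : Set (H →L[ℂ] H) :=
  {T | ∀ M : VonNeumannAlgebra H, R ⊆ (M : Set (H →L[ℂ] H)) → T ∈ M}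

/-- `[R'' M]`: the closed linear span of the vectors `A x` with `A` in the double commutant of `R` and
`x ∈ M`. -/
abbrev bicommutantSpan (R : Set (H →L[ℂ] H)) (M : Set H) : Submodule ℂ H :=
  (Submodule.span ℂ
    {y : H | ∃ A ∈ Set.centralizer (Set.centralizer R), ∃ x ∈ M, y = A x}).topologicalClosure

/-- `L(Sᗮ) ⊕ N P_S`, as a set of operators on `H = Sᗮ ⊕ S`: all operators
`(1 - P_S) X (1 - P_S) + A P_S` with `X` an arbitrary bounded operator and `A ∈ N`. -/
def orthogonalSum (S : Submodule ℂ H) [S.HasOrthogonalProjection] (N : Set (H →L[ℂ] H)) :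
    Set (H →L[ℂ] H) :=
  {T | ∃ X : H →L[ℂ] H, ∃ A ∈ N,
    T = (1 - S.starProjection) * X * (1 - S.starProjection) + A * S.starProjection}

end NormalStates

/-!
Write `Z = R ∪ {K}`, `S = [R'' ran K]` and `P = P_S`; in case (ii) the range of `K` spans the same
cyclic subspace as `v`.

The algebra `L(Sᗮ) ⊕ N P`, with `N` commutative, is beable because `ρ_K` only sees the corner `P`,
where the algebra is commutative: Riesz representation on the Gelfand spectrum of the corner gives a
measure, which is pushed forward along the restriction map to `S`. The algebra is invariant under
the allowed unitaries because those are exactly the unitaries of `Z'`, and they commute with `P`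
and `N`.

Conversely, let `T` belong to an `R`-beable algebra `C`. An integral of dispersion-free states kills
every `c * [A, X]`, so the commutators of `C` vanish on `S`. Differentiating the conjugates
`e^{itb} T e^{-itb}` for self-adjoint `b ∈ Z'` gives `[b, T] ∈ C`. For `b = P` this forces `T` to be
reduced by `S`; for general `b` it shows that `(T P)*` commutes with `[T P, b]`, and an identity for
commutators turns this into `[T P, b] = 0`, that is `T P ∈ Z''`. In case (i) this is the upper
bound.

In case (ii) the upper bound needs `T P ∈ R'' P`. On the cyclic subspace `[R'' v]` the commutant
`R'` is commutative, so `|X P|` commutes with `T` for every `X ∈ R'`, whence `‖X T v‖ ≤ ‖T‖ ‖X v‖`.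
Therefore `X v ↦ X T v` extends to an operator `A ∈ R''`, and `A` agrees with `T` on `S`.
-/

section RieszRepresentation

open MeasureTheory WeakDual

theorem integral_eq_of_integral_realToRCLike {X : Type*} [TopologicalSpace X] [CompactSpace X]
    [MeasurableSpace X] [BorelSpace X] (μ : Measure X) [IsFiniteMeasure μ]
    (τ : C(X, ℂ) →ₗ[ℂ] ℂ)
    (h : ∀ f : C(X, ℝ), τ (f.realToRCLike ℂ) = ∫ x, f x ∂μ) (f : C(X, ℂ)) :
    τ f = ∫ x, f x ∂μ := by
  let u : C(X, ℝ) := ⟨fun x => (f x).re, by fun_prop⟩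
  let w : C(X, ℝ) := ⟨fun x => (f x).im, by fun_prop⟩
  have hf : f = u.realToRCLike ℂ + Complex.I • w.realToRCLike ℂ := by
    ext x
    simp [u, w, mul_comm Complex.I]
  have hint : Integrable f μ :=
    f.continuous.integrable_of_hasCompactSupport (HasCompactSupport.of_compactSpace _)
  rw [hf, map_add, map_smul, h, h, ← hf, ← integral_re_add_im hint, smul_eq_mul, mul_comm]
  rfl

theorem exists_measure_integral_eq {X : Type*} [TopologicalSpace X] [CompactSpace X] [T2Space X]
    [MeasurableSpace X] [BorelSpace X] (τ : C(X, ℂ) →ₚ[ℂ] ℂ) :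
    ∃ μ : Measure X, IsFiniteMeasure μ ∧ ∀ f : C(X, ℂ), τ f = ∫ x, f x ∂μ := by
  have hpos {f : C(X, ℝ)} (hf : 0 ≤ f) : 0 ≤ τ (f.realToRCLike ℂ) :=
    map_nonneg τ (a := f.realToRCLike ℂ) fun x => Complex.zero_le_real.2 (hf x)
  have hreal (f : C(X, ℝ)) : ((τ (f.realToRCLike ℂ)).re : ℂ) = τ (f.realToRCLike ℂ) :=
    Complex.conj_eq_iff_re.1 ((ContinuousMap.isSelfAdjoint_realToRCLike (f := f) ℂ).map τ)
  let Λ : CompactlySupportedContinuousMap X ℝ →ₚ[ℝ] ℝ := .mk₀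
    { toFun := fun f => (τ (f.toContinuousMap.realToRCLike ℂ)).re
      map_add' := fun f g => by
        rw [← Complex.add_re, ← map_add]; congr 2; ext; simp
      map_smul' := fun r f => by
        rw [RingHom.id_apply, smul_eq_mul, ← Complex.re_ofReal_mul, ← smul_eq_mul, ← map_smul]
        congr 2; ext; simp }
    fun f hf => (Complex.nonneg_iff.1 (hpos hf)).1
  refine ⟨RealRMK.rieszMeasure Λ, inferInstance,
    integral_eq_of_integral_realToRCLike _ τ.toLinearMap fun f => ?_⟩
  have hΛ := RealRMK.integral_rieszMeasure Λ ⟨f, HasCompactSupport.of_compactSpace _⟩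
  exact (hreal f).symm.trans (congrArg Complex.ofReal hΛ.symm)

theorem exists_measure_characterSpace {A : Type*} [CommCStarAlgebra A]
    [MeasurableSpace (characterSpace ℂ A)] [BorelSpace (characterSpace ℂ A)] (σ : A →ₗ[ℂ] ℂ)
    (hσ : ∀ a, 0 ≤ σ (star a * a)) (h1 : σ 1 = 1) :
    ∃ μ : Measure (characterSpace ℂ A), IsProbabilityMeasure μ ∧
      ∀ a, σ a = ∫ φ : characterSpace ℂ A, φ a ∂μ := by
  let τ : C(characterSpace ℂ A, ℂ) →ₚ[ℂ] ℂ :=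
    .mk₀ (σ ∘ₗ ((gelfandStarTransform A).symm : C(characterSpace ℂ A, ℂ) →ₗ[ℂ] A)) fun f hf => by
      obtain ⟨g, rfl⟩ := CStarAlgebra.nonneg_iff_eq_star_mul_self.1 hf
      change 0 ≤ σ ((gelfandStarTransform A).symm (star g * g))
      rw [map_mul, map_star]
      exact hσ _
  obtain ⟨μ, _, hμ⟩ := exists_measure_integral_eq τ
  have hσμ (a : A) : σ a = ∫ φ : characterSpace ℂ A, φ a ∂μ := by
    refine Eq.trans ?_ (hμ (gelfandStarTransform A a))
    exact congrArg σ ((gelfandStarTransform A).symm_apply_apply a).symm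
  refine ⟨μ, ⟨?_⟩, hσμ⟩
  have hreal : ((μ.real Set.univ : ℝ) : ℂ) = 1 := by simpa [h1] using (hσμ 1).symm
  exact (ENNReal.toReal_eq_one_iff _).1 (by exact_mod_cast hreal)

end RieszRepresentation

section Beable

open MeasureTheory WeakDual
open scoped CStarAlgebra

section Pullback

variable {B D : Type*} [NormedRing B] [StarRing B] [NormedAlgebra ℂ B] [CommCStarAlgebra D]
  (π : B →⋆ₐ[ℂ] D) (hπ : Continuous π)

/-- The dispersion-free state `χ ∘ π` of `B` obtained by pulling back a character `χ` of a
commutative `C⋆`-algebra along a continuous homomorphism `π`. -/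
noncomputable def characterPullback (χ : characterSpace ℂ D) : dispersionFreeStates B :=
  ⟨StrongDual.toWeakDual
      ⟨(χ : WeakDual ℂ D).toLinearMap ∘ₗ π.toAlgHom.toLinearMap, (map_continuous χ).comp hπ⟩,
    ⟨fun b => by
      change 0 ≤ χ (π (star b * b))
      rw [map_mul, map_mul, map_star, map_star]
      exact star_mul_self_nonneg _,
    by
      change χ (π 1) = 1
      rw [map_one, map_one]⟩,
    fun b x => by
      change χ (π (b * x)) = χ (π b) * χ (π x)
      rw [map_mul, map_mul]⟩

theorem continuous_characterPullback : Continuous (characterPullback π hπ) :=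
  Continuous.subtype_mk (WeakDual.continuous_of_continuous_eval fun b =>
    (WeakDual.eval_continuous (π b)).comp continuous_subtype_val) _

end Pullback

theorem isBeable_of_factor {A D : Type*} [CStarAlgebra A] [CommCStarAlgebra D] (ρ : stateSpace A)
    (B : StarSubalgebra ℂ A) (hB : IsClosed (B : Set A)) (π : B →⋆ₐ[ℂ] D)
    (σ : D →ₗ[ℂ] ℂ) (hσ : ∀ d, 0 ≤ σ (star d * d))
    (h : ∀ b : B, (ρ : WeakDual ℂ A) (b : A) = σ (π b)) : IsBeable ρ B := by
  have hπ : Continuous π := map_continuous π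
  let _ : MeasurableSpace (characterSpace ℂ D) := borel _
  have : BorelSpace (characterSpace ℂ D) := ⟨rfl⟩
  have h1 : σ 1 = 1 := by
    rw [← map_one π, ← h 1]
    exact ρ.2.2
  obtain ⟨μ, hμ, hμσ⟩ := exists_measure_characterSpace σ hσ h1
  have hF := (continuous_characterPullback π hπ).measurable.aemeasurable (μ := μ)
  refine ⟨hB, μ.map (characterPullback π hπ), Measure.isProbabilityMeasure_map hF, fun b => ?_⟩
  rw [integral_map hF, h, hμσ]
  · rfl
  · exact ((WeakDual.eval_continuous b).comp continuous_subtype_val).aestronglyMeasurable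

theorem isBeable_of_commute_range {A D : Type*} [CStarAlgebra A] [CStarAlgebra D]
    (ρ : stateSpace A) (B : StarSubalgebra ℂ A) (hB : IsClosed (B : Set A)) (π : B →⋆ₐ[ℂ] D)
    (hcomm : ∀ b b', Commute (π b) (π b')) (σ : D →ₗ[ℂ] ℂ) (hσ : ∀ d, 0 ≤ σ (star d * d))
    (h : ∀ b : B, (ρ : WeakDual ℂ A) (b : A) = σ (π b)) : IsBeable ρ B := by
  have hrange : ∀ x y : π.range, x * y = y * x := by
    rintro ⟨_, T, rfl⟩ ⟨_, T', rfl⟩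
    exact Subtype.ext (hcomm T T')
  let E := π.range.topologicalClosure
  have hE : IsClosed (E : Set D) := π.range.isClosed_topologicalClosure
  let _ : CommCStarAlgebra E :=
    { StarSubalgebra.cstarAlgebra E with
      mul_comm := (π.range.commRingTopologicalClosure hrange).mul_comm }
  let π' : B →⋆ₐ[ℂ] E := π.codRestrict E fun T => π.range.le_topologicalClosure ⟨T, rfl⟩
  exact isBeable_of_factor ρ B hB π' (σ ∘ₗ E.subtype.toAlgHom.toLinearMap) (fun d => hσ d) h

theorem IsBeable.apply_commutator {A : Type*} [CStarAlgebra A] {ρ : stateSpace A}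
    {B : StarSubalgebra ℂ A} (h : IsBeable ρ B) {a x y : A} (ha : a ∈ B) (hx : x ∈ B)
    (hy : y ∈ B) :
    (ρ : WeakDual ℂ A) (star ((a * x - x * a) * y) * ((a * x - x * a) * y)) = 0 := by
  obtain ⟨-, μ, -, hμ⟩ := h
  let Z : B := (⟨a, ha⟩ * ⟨x, hx⟩ - ⟨x, hx⟩ * ⟨a, ha⟩) * ⟨y, hy⟩
  have hZ (ω : dispersionFreeStates B) : (ω : WeakDual ℂ B) (star Z * Z) = 0 := by
    have hmul (p q : B) : (ω : WeakDual ℂ B) (p * q) =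
        (ω : WeakDual ℂ B) p * (ω : WeakDual ℂ B) q := ω.2.2 p q
    simp only [Z, hmul, map_sub, mul_comm ((ω : WeakDual ℂ B) ⟨x, hx⟩), sub_self, zero_mul,
      mul_zero]
  exact (hμ (star Z * Z)).trans (by simp only [hZ, integral_zero])

end Beable

section DensityOperators

open InnerProductSpace ContinuousLinearMap

variable {H : Type*} [NormedAddCommGroup H] [InnerProductSpace ℂ H] [CompleteSpace H]
  {K : H →L[ℂ] H} (hK : IsDensityOperator K)
include hK

theorem IsDensityOperator.opTrace_mul_rankOne (x y : H) :
    opTrace (K * rankOne ℂ x y) = ⟪y, K x⟫_ℂ := by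
  obtain ⟨_, b, -⟩ := exists_hilbertBasis ℂ H
  have hsum := hK.hasSum_inner b (rankOne ℂ x y)
  simp only [mul_apply_eq_comp, rankOne_apply, map_smul, inner_smul_right] at hsum
  exact hsum.unique (b.hasSum_inner_mul_inner y (K x))

theorem IsDensityOperator.mul_eq_zero_of_opTrace {Z : H →L[ℂ] H}
    (hZ : opTrace (K * (star Z * Z)) = 0) : Z * K = 0 := by
  obtain ⟨κ, x, -, hx⟩ := hK.exists_sandwich
  have hZx (j : κ) : Z (x j) = 0 := by
    have hsq (j : κ) : ⟪x j, (star Z * Z) (x j)⟫_ℂ = ((‖Z (x j)‖ ^ 2 : ℝ) : ℂ) := by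
      rw [mul_apply_eq_comp, star_eq_adjoint, adjoint_inner_right, inner_self_eq_norm_sq_to_K,
        Complex.ofReal_pow]
      rfl
    have hsum := hx (star Z * Z)
    simp only [hsq, hZ, ← Complex.ofReal_zero, Complex.hasSum_ofReal] at hsum
    have hzero := (hasSum_zero_iff_of_nonneg fun j => sq_nonneg ‖Z (x j)‖).1 hsum
    simpa using congrFun hzero j
  ext y
  refine ext_inner_left ℂ fun z => ?_
  rw [mul_apply_eq_comp, zero_apply, inner_zero_right, ← adjoint_inner_left,
    ← hK.opTrace_mul_rankOne]
  refine (hx _).unique ?_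
  simp only [rankOne_apply, adjoint_inner_left, hZx, inner_zero_right, zero_smul, hasSum_zero]

theorem IsDensityOperator.commute_of_invariant {U : H →L[ℂ] H}
    (hU : U ∈ unitary (H →L[ℂ] H))
    (h : ∀ X : H →L[ℂ] H, opTrace (K * (star U * X * U)) = opTrace (K * X)) : Commute U K := by
  have hconj : U * K * star U = K := by
    ext x
    refine ext_inner_left ℂ fun y => ?_
    have hstar : star U * rankOne ℂ x y * U = rankOne ℂ (star U x) (star U y) := by
      simp only [mul_def, comp_rankOne, rankOne_comp, star_eq_adjoint]
    have hxy := h (rankOne ℂ x y)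
    rwa [hstar, hK.opTrace_mul_rankOne, hK.opTrace_mul_rankOne, star_eq_adjoint,
      adjoint_inner_left] at hxy
  calc U * K = U * K * (star U * U) := by rw [Unitary.star_mul_self_of_mem hU, mul_one]
    _ = K * U := by rw [← mul_assoc, hconj]

theorem IsDensityOperator.opTrace_conj {U : H →L[ℂ] H} (hU : U ∈ unitary (H →L[ℂ] H))
    (h : Commute U K) (X : H →L[ℂ] H) : opTrace (K * (star U * X * U)) = opTrace (K * X) := by
  obtain ⟨_, b, -⟩ := exists_hilbertBasis ℂ H
  let b' := HilbertBasis.ofRepr ((Unitary.linearIsometryEquiv ⟨U, hU⟩).symm.trans b.repr)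
  have hstar : star U * K = K * star U := by
    simpa only [star_mul, hK.1.isSelfAdjoint.star_eq] using (congrArg star h.eq).symm
  refine (hK.hasSum_inner b _).unique ?_
  convert hK.hasSum_inner b' X using 2 with i
  rw [← mul_assoc, ← mul_assoc, ← hstar, mul_assoc, mul_assoc, mul_apply_eq_comp, star_eq_adjoint,
    adjoint_inner_right]
  rfl

end DensityOperators

section Compression

open ContinuousLinearMap

variable {H : Type*} [NormedAddCommGroup H] [InnerProductSpace ℂ H] [CompleteSpace H]
  (S : Submodule ℂ H) [CompleteSpace S]

/-- The homomorphism `T ↦ T|_S` to the operators on a closed subspace `S` that reduces every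
operator of `B`; it is encoded as the compression `T ↦ P_S T|_S`. -/
noncomputable def restrictHom (B : StarSubalgebra ℂ (H →L[ℂ] H))
    (hB : ∀ T ∈ B, Commute T S.starProjection) : B →⋆ₐ[ℂ] (S →L[ℂ] S) where
  toFun T := S.orthogonalProjectionOnto ∘L (T : H →L[ℂ] H) ∘L S.subtypeL
  map_one' := by ext; simp
  map_mul' T T' := by
    ext x
    have hx := congr($((hB T' T'.2).eq) x)
    simp only [mul_apply_eq_comp, Submodule.starProjection_mem_subspace_eq_self] at hx
    simp [← hx]
  map_zero' := by ext; simp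
  map_add' T T' := by ext; simp
  commutes' r := by ext; simp [Algebra.algebraMap_eq_smul_one]
  map_star' T := by
    simp only [star_eq_adjoint, adjoint_comp, Submodule.adjoint_subtypeL,
      Submodule.adjoint_orthogonalProjectionOnto, StarMemClass.coe_star, comp_assoc]

/-- The extension by zero to `H` of an operator on the closed subspace `S`. -/
noncomputable def extendZero : (S →L[ℂ] S) →ₗ[ℂ] (H →L[ℂ] H) where
  toFun X := S.subtypeL ∘L X ∘L S.orthogonalProjectionOnto
  map_add' X Y := by ext; simp
  map_smul' c X := by ext; simp

theorem extendZero_star_mul (X : S →L[ℂ] S) :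
    extendZero S (star X * X) = star (extendZero S X) * extendZero S X := by
  simp only [extendZero, LinearMap.coe_mk, AddHom.coe_mk, star_eq_adjoint, adjoint_comp,
    Submodule.adjoint_subtypeL, Submodule.adjoint_orthogonalProjectionOnto]
  ext x
  simp

variable {S}

theorem extendZero_restrictHom {B : StarSubalgebra ℂ (H →L[ℂ] H)}
    (hB : ∀ T ∈ B, Commute T S.starProjection) (T : B) :
    extendZero S (restrictHom S B hB T) = S.starProjection * T := by
  calc S.starProjection * (T * S.starProjection)
      = S.starProjection * (S.starProjection * T) := by rw [(hB T T.2).eq]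
    _ = S.starProjection * T := by rw [← mul_assoc, S.isIdempotentElem_starProjection.eq]

theorem isBeable_of_reduces {K : H →L[ℂ] H} (hK : IsDensityOperator K)
    (hKS : K * S.starProjection = K) {B : StarSubalgebra ℂ (H →L[ℂ] H)}
    (hcl : IsClosed (B : Set (H →L[ℂ] H))) (hB : ∀ T ∈ B, Commute T S.starProjection)
    (hcomm : ∀ T ∈ B, ∀ T' ∈ B, T * T' * S.starProjection = T' * T * S.starProjection) :
    IsBeable (normalState K hK) B := by
  refine isBeable_of_commute_range (D := S →L[ℂ] S) (normalState K hK) B hcl (restrictHom S B hB)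
    (fun T T' => ?_) ((normalState K hK : WeakDual ℂ (H →L[ℂ] H)).toLinearMap ∘ₗ extendZero S)
    (fun X => ?_) (fun T => ?_)
  · change _ * _ = _ * _
    rw [← map_mul, ← map_mul]
    ext x
    have hx := congr($(hcomm T T.2 T' T'.2) x)
    simp only [mul_apply_eq_comp, Submodule.starProjection_mem_subspace_eq_self] at hx
    simp [restrictHom, hx]
  · change 0 ≤ (normalState K hK : WeakDual ℂ (H →L[ℂ] H)) (extendZero S (star X * X))
    rw [extendZero_star_mul]
    exact (normalState K hK).2.1 _
  · change opTrace (K * (T : H →L[ℂ] H)) = opTrace (K * extendZero S (restrictHom S B hB T))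
    rw [extendZero_restrictHom, ← mul_assoc, hKS]

end Compression

section InfinitesimalConjugation

variable {A : Type*} [CStarAlgebra A]

theorem deriv_exp_smul_mul_mul_exp_smul_neg (x T : A) :
    deriv (fun t : ℝ => NormedSpace.exp (t • x) * T * NormedSpace.exp (t • -x)) 0 =
      x * T - T * x := by
  let _ : NormedAlgebra ℚ A := .restrictScalars ℚ ℂ A
  have h := ((hasDerivAt_exp_smul_const (𝕂 := ℝ) x 0).mul_const T).mul
    (hasDerivAt_exp_smul_const (𝕂 := ℝ) (-x) 0)
  simp only [zero_smul, NormedSpace.exp_zero, one_mul, mul_one, mul_neg, ← sub_eq_add_neg] at h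
  exact h.deriv

theorem mul_sub_mul_mem_of_isSelfAdjoint {V : Submodule ℂ A} (hV : IsClosed (V : Set A))
    {M : StarSubalgebra ℂ A} (hM : IsClosed (M : Set A)) {T : A}
    (hT : ∀ u ∈ unitary A, u ∈ M → u * T * star u ∈ V) {b : A} (hb : b ∈ M)
    (hbsa : IsSelfAdjoint b) : b * T - T * b ∈ V := by
  let _ : NormedAlgebra ℚ A := .restrictScalars ℚ ℂ A
  have hx : Complex.I • b ∈ skewAdjoint A := hbsa.smul_mem_skewAdjoint Complex.conj_I
  have hpath (t : ℝ) : NormedSpace.exp (t • Complex.I • b) * T *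
      NormedSpace.exp (t • -(Complex.I • b)) ∈ V.restrictScalars ℝ := by
    have hu := NormedSpace.exp_mem_unitary_of_mem_skewAdjoint (skewAdjoint.smul_mem t hx)
    have huM : NormedSpace.exp (t • Complex.I • b) ∈ M :=
      NormedSpace.exp_mem (R := ℂ) hM <| by
        rw [← Complex.coe_smul]
        exact M.smul_mem (M.smul_mem hb _) _
    have hstar : star (NormedSpace.exp (t • Complex.I • b)) =
        NormedSpace.exp (t • -(Complex.I • b)) := by
      rw [NormedSpace.star_exp, star_smul, skewAdjoint.mem_iff.1 hx, star_trivial]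
    exact hstar ▸ hT _ hu huM
  have hspan := Submodule.span_le.2 (Set.image_subset_iff.2 fun t (_ : t ∈ Set.univ) => hpath t)
  have hI := closure_minimal hspan hV
    (range_deriv_subset_closure_span_image _ dense_univ (Set.mem_range_self 0))
  rw [deriv_exp_smul_mul_mul_exp_smul_neg, smul_mul_assoc, mul_smul_comm, ← smul_sub] at hI
  exact (V.smul_mem_iff Complex.I_ne_zero).1 hI

theorem mul_sub_mul_mem_of_unitary_conj {V : Submodule ℂ A} (hV : IsClosed (V : Set A))
    {M : StarSubalgebra ℂ A} (hM : IsClosed (M : Set A)) {T : A}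
    (hT : ∀ u ∈ unitary A, u ∈ M → u * T * star u ∈ V) {b : A} (hb : b ∈ M) :
    b * T - T * b ∈ V := by
  have hre : (realPart b : A) ∈ M := by
    rw [realPart_apply_coe, ← Complex.coe_smul]
    exact M.smul_mem (add_mem hb (star_mem hb)) _
  have him : (imaginaryPart b : A) ∈ M := by
    rw [imaginaryPart_apply_coe, ← Complex.coe_smul]
    exact M.smul_mem (M.smul_mem (sub_mem hb (star_mem hb)) _) _
  have hsum := V.add_mem (mul_sub_mul_mem_of_isSelfAdjoint hV hM hT hre (realPart b).2)
    (V.smul_mem Complex.I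
      (mul_sub_mul_mem_of_isSelfAdjoint hV hM hT him (imaginaryPart b).2))
  have hb_eq := realPart_add_I_smul_imaginaryPart b
  rw [← hb_eq, add_mul, mul_add, smul_mul_assoc, mul_smul_comm]
  convert hsum using 1
  module

end InfinitesimalConjugation

section CommutatorIdentity

variable {A : Type*} [CStarAlgebra A]

theorem commute_of_commute_star_commutator {T b : A}
    (h : Commute (star T) (T * b - b * T)) (h' : Commute (star T) (T * star b - star b * T))
    (h'' : Commute (star T) (T * (star b * b) - star b * b * T)) : Commute T b := by
  let _ : PartialOrder A := CStarAlgebra.spectralOrder A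
  let _ : StarOrderedRing A := CStarAlgebra.spectralOrderedRing A
  let D := T * b - b * T
  let E := star T * b - b * star T
  have hsum : star D * D + star E * E = 0 := by
    have leibniz : star D * D + star E * E =
        (star T * (T * star b - star b * T) - (T * star b - star b * T) * star T) * b +
          star b * (star T * (T * b - b * T) - (T * b - b * T) * star T) -
          (star T * (T * (star b * b) - star b * b * T) -
            (T * (star b * b) - star b * b * T) * star T) := by
      simp only [D, E, star_sub, star_mul, star_star]
      noncomm_ring
    rw [leibniz, sub_eq_zero.2 h.eq, sub_eq_zero.2 h'.eq, sub_eq_zero.2 h''.eq]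
    simp only [zero_mul, mul_zero, add_zero, sub_zero]
  have hD : star D * D = 0 :=
    ((add_eq_zero_iff_of_nonneg (star_mul_self_nonneg D) (star_mul_self_nonneg E)).1 hsum).1
  exact sub_eq_zero.1 ((CStarRing.star_mul_self_eq_zero_iff D).1 hD)

end CommutatorIdentity

section Commutants

variable {H : Type*} [NormedAddCommGroup H] [InnerProductSpace ℂ H]
  {R Z : Set (H →L[ℂ] H)} {M : Set H}

theorem starProjection_mul_of_range_subset {S : Submodule ℂ H} [S.HasOrthogonalProjection]
    {K : H →L[ℂ] H} (h : Set.range K ⊆ S) : S.starProjection * K = K := by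
  ext x
  exact Submodule.starProjection_eq_self_iff.2 (h ⟨x, rfl⟩)

theorem apply_mem_bicommutantSpan {A : H →L[ℂ] H} (hA : A ∈ R.centralizer.centralizer) {x : H}
    (hx : x ∈ M) : A x ∈ bicommutantSpan R M :=
  Submodule.le_topologicalClosure _ (Submodule.subset_span ⟨A, hA, x, hx, rfl⟩)

theorem subset_bicommutantSpan : M ⊆ bicommutantSpan R M := fun _ hx =>
  apply_mem_bicommutantSpan (A := 1) Set.one_mem_centralizer hx

theorem bicommutantSpan_le_of_forall {V : Submodule ℂ H} (hV : IsClosed (V : Set H))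
    (h : ∀ A ∈ R.centralizer.centralizer, ∀ x ∈ M, A x ∈ V) : bicommutantSpan R M ≤ V := by
  refine Submodule.topologicalClosure_minimal _ (Submodule.span_le.2 ?_) hV
  rintro _ ⟨A, hA, x, hx, rfl⟩
  exact h A hA x hx

theorem mapsTo_bicommutantSpan {X : H →L[ℂ] H}
    (h : ∀ A ∈ R.centralizer.centralizer, ∀ x ∈ M, X (A x) ∈ bicommutantSpan R M) :
    ∀ y ∈ bicommutantSpan R M, X y ∈ bicommutantSpan R M := by
  have hcl : IsClosed ((bicommutantSpan R M).comap (X : H →ₗ[ℂ] H) : Set H) :=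
    (Submodule.isClosed_topologicalClosure _).preimage X.continuous
  exact fun y hy => bicommutantSpan_le_of_forall (M := M) hcl h hy

theorem mapsTo_bicommutantSpan_of_mem_bicommutant {B : H →L[ℂ] H}
    (hB : B ∈ R.centralizer.centralizer) :
    ∀ y ∈ bicommutantSpan R M, B y ∈ bicommutantSpan R M :=
  mapsTo_bicommutantSpan fun _ hA _ hx =>
    apply_mem_bicommutantSpan (Set.mul_mem_centralizer hB hA) hx

theorem mapsTo_bicommutantSpan_of_mem_centralizer {X : H →L[ℂ] H} (hX : X ∈ R.centralizer)
    (h : ∀ x ∈ M, X x ∈ bicommutantSpan R M) :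
    ∀ y ∈ bicommutantSpan R M, X y ∈ bicommutantSpan R M := by
  refine mapsTo_bicommutantSpan fun A hA x hx => ?_
  rw [show X (A x) = A (X x) from congr($(hA X hX) x)]
  exact mapsTo_bicommutantSpan_of_mem_bicommutant hA _ (h x hx)

theorem bicommutantSpan_closure_span :
    bicommutantSpan R (closure (Submodule.span ℂ M)) = bicommutantSpan R M := by
  have hcl {N : Set H} : IsClosed (bicommutantSpan R N : Set H) :=
    Submodule.isClosed_topologicalClosure _
  refine le_antisymm (bicommutantSpan_le_of_forall hcl fun A hA x hx => ?_)
    (bicommutantSpan_le_of_forall hcl fun A hA x hx =>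
      apply_mem_bicommutantSpan hA (subset_closure (Submodule.subset_span hx)))
  exact mapsTo_bicommutantSpan_of_mem_bicommutant hA x
    (closure_minimal (Submodule.span_le.2 subset_bicommutantSpan) hcl hx)

variable [CompleteSpace H]

theorem commute_starProjection_iff {S : Submodule ℂ H} [S.HasOrthogonalProjection]
    {X : H →L[ℂ] H} :
    Commute X S.starProjection ↔ (∀ x ∈ S, X x ∈ S) ∧ ∀ x ∈ S, star X x ∈ S := by
  have h := ContinuousLinearMap.IsIdempotentElem.commute_iff (T := X)
    S.isIdempotentElem_starProjection
  rw [Submodule.range_starProjection, Submodule.ker_starProjection,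
    ← ContinuousLinearMap.mem_invtSubmodule_adjoint_iff] at h
  exact Commute.symm_iff.trans h

theorem starProjection_bicommutantSpan_mem_centralizer
    (hR : ∀ X ∈ R.centralizer, star X ∈ R.centralizer) :
    (bicommutantSpan R M).starProjection ∈ R.centralizer := by
  have hR'' : ∀ B ∈ R.centralizer.centralizer,
      Commute B (bicommutantSpan R M).starProjection := fun B hB => commute_starProjection_iff.2
    ⟨mapsTo_bicommutantSpan_of_mem_bicommutant hB,
      mapsTo_bicommutantSpan_of_mem_bicommutant (Set.star_mem_centralizer' hR hB)⟩
  exact fun A hA => hR'' A (Set.subset_centralizer_centralizer hA)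

theorem bicommutantSpan_le {V : Submodule ℂ H} (hV : IsClosed (V : Set H))
    (hM : M ⊆ V) (h : ∀ A ∈ R, ∀ x ∈ V, A x ∈ V) (h' : ∀ A ∈ R, ∀ x ∈ V, star A x ∈ V) :
    bicommutantSpan R M ≤ V := by
  have : CompleteSpace V := hV.completeSpace_coe
  have hP : V.starProjection ∈ R.centralizer := fun A hA =>
    commute_starProjection_iff.2 ⟨h A hA, h' A hA⟩
  exact bicommutantSpan_le_of_forall hV fun A hA x hx =>
    (commute_starProjection_iff.1 (hA _ hP).symm).1 x (hM hx)

theorem star_mem_centralizer_of_isStarNormal (hZ : ∀ A ∈ Z, IsStarNormal A) :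
    ∀ X ∈ Z.centralizer, star X ∈ Z.centralizer := fun X hX A hA => by
  have h : Commute (star A) X := (hZ A hA).commute_star_left (hX A hA)
  simpa only [star_star] using h.star_star.eq

theorem coe_starSubalgebra_centralizer (hZ : ∀ X ∈ Z.centralizer, star X ∈ Z.centralizer) :
    (StarSubalgebra.centralizer ℂ Z : Set (H →L[ℂ] H)) = Z.centralizer := by
  rw [StarSubalgebra.coe_centralizer]
  refine (Set.centralizer_subset Set.subset_union_left).antisymm fun X hX => ?_
  rw [Set.centralizer_union]
  refine ⟨hX, fun A hA => ?_⟩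
  have h : Commute (star A) (star X) := hZ X hX _ hA
  simpa only [star_star] using h.star_star.eq

theorem vonNeumannGenerated_eq_centralizer_centralizer
    (hZ : ∀ X ∈ Z.centralizer, star X ∈ Z.centralizer) :
    vonNeumannGenerated Z = Z.centralizer.centralizer := by
  have hcoe : (StarSubalgebra.centralizer ℂ Z.centralizer : Set (H →L[ℂ] H)) =
      Z.centralizer.centralizer :=
    coe_starSubalgebra_centralizer fun X hX => Set.star_mem_centralizer' hZ hX
  apply Set.Subset.antisymm
  · intro T hT
    let N : VonNeumannAlgebra H :=
      { StarSubalgebra.centralizer ℂ Z.centralizer with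
        centralizer_centralizer' := by
          change (StarSubalgebra.centralizer ℂ Z.centralizer :
            Set (H →L[ℂ] H)).centralizer.centralizer = StarSubalgebra.centralizer ℂ Z.centralizer
          rw [hcoe, Set.centralizer_centralizer_centralizer] }
    have hN : (N : Set (H →L[ℂ] H)) = Z.centralizer.centralizer := hcoe
    have hTN : T ∈ (N : Set (H →L[ℂ] H)) := hT N (hN ▸ Set.subset_centralizer_centralizer)
    exact hN ▸ hTN
  · intro T hT N hN
    rw [← SetLike.mem_coe, ← N.centralizer_centralizer]
    exact Set.centralizer_subset (Set.centralizer_subset hN) hT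

end Commutants

section RangeSubspace

variable {H : Type*} [NormedAddCommGroup H] [InnerProductSpace ℂ H] [CompleteSpace H]
  {R : Set (H →L[ℂ] H)} {K : H →L[ℂ] H}

theorem starProjection_bicommutantSpan_mul_self :
    (bicommutantSpan R (closure (Set.range K))).starProjection * K = K :=
  starProjection_mul_of_range_subset (subset_closure.trans subset_bicommutantSpan)

theorem mul_starProjection_bicommutantSpan_self (hK : IsSelfAdjoint K) :
    K * (bicommutantSpan R (closure (Set.range K))).starProjection = K := by
  have h := congrArg star (starProjection_bicommutantSpan_mul_self (R := R) (K := K))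
  rwa [star_mul, hK.star_eq, (isSelfAdjoint_starProjection _).star_eq] at h

theorem starProjection_bicommutantSpan_range_mem_centralizer
    (hR : ∀ X ∈ R.centralizer, star X ∈ R.centralizer) (hK : IsSelfAdjoint K) :
    (bicommutantSpan R (closure (Set.range K))).starProjection ∈ (R ∪ {K}).centralizer := by
  rw [Set.centralizer_union]
  refine ⟨starProjection_bicommutantSpan_mem_centralizer hR, ?_⟩
  rintro _ rfl
  rw [mul_starProjection_bicommutantSpan_self hK, starProjection_bicommutantSpan_mul_self]

theorem starProjection_bicommutantSpan_range_mem_bicommutant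
    (hZ : ∀ X ∈ (R ∪ {K}).centralizer, star X ∈ (R ∪ {K}).centralizer) :
    (bicommutantSpan R (closure (Set.range K))).starProjection ∈
      (R ∪ {K}).centralizer.centralizer := by
  have hinv : ∀ X ∈ (R ∪ {K}).centralizer, ∀ x ∈ bicommutantSpan R (closure (Set.range K)),
      X x ∈ bicommutantSpan R (closure (Set.range K)) := by
    intro X hX
    have hXK : Set.MapsTo X (Set.range K) (Set.range K) := by
      rintro _ ⟨y, rfl⟩
      exact ⟨X y, congr($(hX K (Or.inr rfl)) y)⟩
    exact mapsTo_bicommutantSpan_of_mem_centralizer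
      (Set.centralizer_subset Set.subset_union_left hX)
      fun x hx => subset_bicommutantSpan (hXK.closure X.continuous hx)
  exact fun X hX => commute_starProjection_iff.2 ⟨hinv X hX, hinv _ (hZ X hX)⟩

end RangeSubspace

section OrthogonalSum

theorem mul_mul_congr_of_commute {M : Type*} [Semigroup M] {p t u a b : M} (hu : Commute u p)
    (hta : t * p = a * p) (hub : u * p = b * p) : t * u * p = a * b * p :=
  calc t * u * p = t * p * u := by rw [mul_assoc, hu.eq, mul_assoc]
    _ = a * (u * p) := by rw [hta, mul_assoc, hu.eq]
    _ = a * b * p := by rw [hub, mul_assoc]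

variable {H : Type*} [NormedAddCommGroup H] [InnerProductSpace ℂ H]

theorem mem_orthogonalSum_iff {S : Submodule ℂ H} [S.HasOrthogonalProjection]
    {N : Set (H →L[ℂ] H)} (hN : ∀ A ∈ N, Commute A S.starProjection) {T : H →L[ℂ] H} :
    T ∈ orthogonalSum S N ↔
      Commute T S.starProjection ∧ ∃ A ∈ N, T * S.starProjection = A * S.starProjection := by
  have hP : IsIdempotentElem S.starProjection := S.isIdempotentElem_starProjection
  have hTQ {X : H →L[ℂ] H} : (1 - S.starProjection) * X * (1 - S.starProjection) *
      S.starProjection = 0 := by rw [mul_assoc, hP.one_sub_mul_self, mul_zero]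
  constructor
  · rintro ⟨X, A, hA, rfl⟩
    refine ⟨.add_left ?_ ((hN A hA).mul_left rfl), A, hA, ?_⟩
    · rw [commute_iff_eq, hTQ, mul_assoc, ← mul_assoc, hP.mul_one_sub_self, zero_mul]
    · rw [add_mul, hTQ, zero_add, mul_assoc, hP.eq]
  · rintro ⟨hT, A, hA, hTA⟩
    refine ⟨T, A, hA, ?_⟩
    have hTQ' : (1 - S.starProjection) * T = T * (1 - S.starProjection) :=
      ((Commute.one_left T).sub_left hT.symm).eq
    rw [hTQ', mul_assoc, hP.one_sub.eq, ← hTA, mul_sub, mul_one, sub_add_cancel]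

variable [CompleteSpace H]

/-- `L(Sᗮ) ⊕ N P_S` as a star-subalgebra, for an algebra `N` that is reduced by `S`. -/
def orthogonalSumSubalgebra (S : Submodule ℂ H) [S.HasOrthogonalProjection]
    (N : StarSubalgebra ℂ (H →L[ℂ] H)) (hN : ∀ A ∈ N, Commute A S.starProjection) :
    StarSubalgebra ℂ (H →L[ℂ] H) where
  carrier := orthogonalSum S N
  mul_mem' {T U} hT hU := by
    obtain ⟨hT, A, hA, hTA⟩ := (mem_orthogonalSum_iff hN).1 hT
    obtain ⟨hU, B, hB, hUB⟩ := (mem_orthogonalSum_iff hN).1 hU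
    refine (mem_orthogonalSum_iff hN).2 ⟨hT.mul_left hU, A * B, mul_mem hA hB,
      mul_mul_congr_of_commute hU hTA hUB⟩
  add_mem' {T U} hT hU := by
    obtain ⟨hT, A, hA, hTA⟩ := (mem_orthogonalSum_iff hN).1 hT
    obtain ⟨hU, B, hB, hUB⟩ := (mem_orthogonalSum_iff hN).1 hU
    exact (mem_orthogonalSum_iff hN).2
      ⟨hT.add_left hU, A + B, add_mem hA hB, by rw [add_mul, hTA, hUB, add_mul]⟩
  algebraMap_mem' r :=
    (mem_orthogonalSum_iff hN).2 ⟨Algebra.commutes r _, _, algebraMap_mem N r, rfl⟩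
  star_mem' {T} hT := by
    obtain ⟨hT, A, hA, hTA⟩ := (mem_orthogonalSum_iff hN).1 hT
    have hP : star S.starProjection = S.starProjection := isSelfAdjoint_starProjection S
    have hstar {X : H →L[ℂ] H} (hX : Commute X S.starProjection) :
        Commute (star X) S.starProjection := by simpa only [hP] using hX.star_star
    refine (mem_orthogonalSum_iff hN).2 ⟨hstar hT, star A, star_mem hA, ?_⟩
    rw [hstar hT, hstar (hN A hA)]
    simpa only [star_mul, hP] using congr(star $hTA)

theorem isClosed_orthogonalSum {S : Submodule ℂ H} [S.HasOrthogonalProjection]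
    {N : Set (H →L[ℂ] H)} (hN : ∀ A ∈ N, Commute A S.starProjection)
    (hcl : IsClosed ((· * S.starProjection) '' N)) : IsClosed (orthogonalSum S N) := by
  have heq : orthogonalSum S N = {T | T * S.starProjection = S.starProjection * T} ∩
      (· * S.starProjection) ⁻¹' ((· * S.starProjection) '' N) := by
    ext T
    simp only [mem_orthogonalSum_iff hN, Set.mem_inter_iff, Set.mem_preimage, Set.mem_image,
      Set.mem_ofPred_eq, commute_iff_eq, eq_comm (a := T * S.starProjection)]
  rw [heq]
  exact (isClosed_eq (by fun_prop) (by fun_prop)).inter (hcl.preimage (by fun_prop))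

end OrthogonalSum

section OrthogonalSumBeable

variable {H : Type*} [NormedAddCommGroup H] [InnerProductSpace ℂ H] [CompleteSpace H]
  {R : Set (H →L[ℂ] H)} {K : H →L[ℂ] H}

theorem isRBeable_of_conj_mem (hK : IsDensityOperator K) {B : StarSubalgebra ℂ (H →L[ℂ] H)}
    (hZ : ∀ X ∈ (R ∪ {K}).centralizer, star X ∈ (R ∪ {K}).centralizer)
    (hB : IsBeable (normalState K hK) B) (hRB : R ⊆ B)
    (hU : ∀ U ∈ unitary (H →L[ℂ] H), U ∈ (R ∪ {K}).centralizer → ∀ T ∈ B, U * T * star U ∈ B) :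
    IsRBeable R (normalState K hK) B where
  beable := hB
  priv := hRB
  definable U hUu hUR hinv := by
    have hUZ : U ∈ (R ∪ {K}).centralizer := by
      rw [Set.centralizer_union]
      refine ⟨hUR, ?_⟩
      rintro _ rfl
      exact (hK.commute_of_invariant hUu hinv).symm
    refine Set.Subset.antisymm (Set.image_subset_iff.2 (hU U hUu hUZ)) fun T hT => ?_
    refine ⟨star U * T * star (star U), hU _ (Unitary.star_mem hUu) (hZ U hUZ) T hT, ?_⟩
    calc U * (star U * T * star (star U)) * star U = U * star U * T * (U * star U) := by
          simp only [star_star, mul_assoc]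
      _ = T := by rw [Unitary.mul_star_self_of_mem hUu, one_mul, mul_one]

theorem isRBeable_orthogonalSumSubalgebra (hK : IsDensityOperator K) {S : Submodule ℂ H}
    [CompleteSpace S] {N : StarSubalgebra ℂ (H →L[ℂ] H)}
    (hZ : ∀ X ∈ (R ∪ {K}).centralizer, star X ∈ (R ∪ {K}).centralizer)
    (hNP : ∀ A ∈ N, Commute A S.starProjection) (hKP : K * S.starProjection = K)
    (hP : S.starProjection ∈ (R ∪ {K}).centralizer.centralizer)
    (hRN : R ⊆ N) (hNZ : (N : Set (H →L[ℂ] H)) ⊆ (R ∪ {K}).centralizer.centralizer)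
    (hcomm : ∀ A ∈ N, ∀ B ∈ N, Commute A B)
    (hcl : IsClosed ((· * S.starProjection) '' (N : Set (H →L[ℂ] H)))) :
    IsRBeable R (normalState K hK) (orthogonalSumSubalgebra S N hNP) := by
  have hmem {T : H →L[ℂ] H} : T ∈ orthogonalSumSubalgebra S N hNP ↔
      Commute T S.starProjection ∧ ∃ A ∈ N, T * S.starProjection = A * S.starProjection :=
    mem_orthogonalSum_iff hNP
  refine isRBeable_of_conj_mem hK hZ ?_ ?_ ?_
  · refine isBeable_of_reduces hK hKP (isClosed_orthogonalSum hNP hcl)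
      (fun T hT => (hmem.1 hT).1) fun T hT U hU => ?_
    obtain ⟨hT, A, hA, hTA⟩ := hmem.1 hT
    obtain ⟨hU, B, hB, hUB⟩ := hmem.1 hU
    calc T * U * S.starProjection = A * B * S.starProjection := mul_mul_congr_of_commute hU hTA hUB
      _ = B * A * S.starProjection := by rw [(hcomm A hA B hB).eq]
      _ = U * T * S.starProjection := (mul_mul_congr_of_commute hT hUB hTA).symm
  · exact fun A hA => hmem.2 ⟨hNP A (hRN hA), A, hRN hA, rfl⟩
  · intro U hUu hUZ T hT
    obtain ⟨hT, A, hA, hTA⟩ := hmem.1 hT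
    have hUP : Commute U S.starProjection := hP U hUZ
    have hUP' : Commute (star U) S.starProjection := hP _ (hZ U hUZ)
    have hUA : Commute U A := hNZ hA U hUZ
    refine hmem.2 ⟨(hUP.mul_left hT).mul_left hUP', A, hA, ?_⟩
    calc U * T * star U * S.starProjection = U * A * star U * S.starProjection :=
          mul_mul_congr_of_commute hUP' (mul_mul_congr_of_commute hT rfl hTA) rfl
      _ = A * S.starProjection := by
          rw [hUA.eq, mul_assoc A, Unitary.mul_star_self_of_mem hUu, mul_one]

end OrthogonalSumBeable

section UpperBound

variable {H : Type*} [NormedAddCommGroup H] [InnerProductSpace ℂ H] [CompleteSpace H]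
  {R : Set (H →L[ℂ] H)} {K : H →L[ℂ] H} {hK : IsDensityOperator K}
  {C : StarSubalgebra ℂ (H →L[ℂ] H)}

theorem IsRBeable.mul_sub_mul_mem (hC : IsRBeable R (normalState K hK) C)
    (hZ : ∀ X ∈ (R ∪ {K}).centralizer, star X ∈ (R ∪ {K}).centralizer) {b T : H →L[ℂ] H}
    (hb : b ∈ (R ∪ {K}).centralizer) (hT : T ∈ C) : b * T - T * b ∈ C := by
  have hM := coe_starSubalgebra_centralizer hZ
  refine mul_sub_mul_mem_of_unitary_conj (V := Subalgebra.toSubmodule C.toSubalgebra)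
    hC.beable.1 (M := StarSubalgebra.centralizer ℂ (R ∪ {K}))
    (Set.isClosed_centralizer _) (fun U hU hUM => ?_) (hM.ge hb)
  have hUZ : U ∈ (R ∪ {K}).centralizer := hM.le hUM
  have hUK : Commute U K := (hUZ K (.inr rfl)).symm
  have himage := hC.definable U hU (fun A hA => hUZ A (.inl hA)) (hK.opTrace_conj hU hUK)
  exact himage.subset ⟨T, hT, rfl⟩

theorem IsRBeable.commutator_apply_eq_zero (hC : IsRBeable R (normalState K hK) C)
    {a x : H →L[ℂ] H} (ha : a ∈ C) (hx : x ∈ C) {z : H}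
    (hz : z ∈ bicommutantSpan R (closure (Set.range K))) : (a * x - x * a) z = 0 := by
  let V : Submodule ℂ H := ⨅ y : C, ((a * x - x * a) * (y : H →L[ℂ] H)).ker
  have hmem (z : H) : z ∈ V ↔ ∀ y ∈ C, (a * x - x * a) (y z) = 0 := by
    simp only [V, Submodule.mem_iInf, Subtype.forall]
    rfl
  have hV : IsClosed (V : Set H) := by
    simp only [V, Submodule.coe_iInf]
    exact isClosed_iInter fun y => ContinuousLinearMap.isClosed_ker _
  have hran : Set.range K ⊆ V := by
    rintro _ ⟨z, rfl⟩
    refine (hmem _).2 fun y hy => ?_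
    exact congr($(hK.mul_eq_zero_of_opTrace (hC.beable.apply_commutator ha hx hy)) z)
  have hCV : ∀ y ∈ C, ∀ z ∈ V, y z ∈ V := fun y hy z hz =>
    (hmem _).2 fun y' hy' => (hmem z).1 hz (y' * y) (mul_mem hy' hy)
  have hle := bicommutantSpan_le hV (closure_minimal hran hV)
    (fun A hA => hCV A (hC.priv hA)) fun A hA => hCV _ (star_mem (hC.priv hA))
  exact (hmem z).1 (hle hz) 1 (one_mem C)

theorem IsRBeable.commutator_mul_starProjection (hC : IsRBeable R (normalState K hK) C)
    {a x : H →L[ℂ] H} (ha : a ∈ C) (hx : x ∈ C) :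
    a * x * (bicommutantSpan R (closure (Set.range K))).starProjection =
      x * a * (bicommutantSpan R (closure (Set.range K))).starProjection := by
  rw [← sub_eq_zero, ← sub_mul]
  ext z
  exact hC.commutator_apply_eq_zero ha hx (Submodule.starProjection_apply_mem _ z)

theorem IsRBeable.commute_starProjection (hC : IsRBeable R (normalState K hK) C)
    (hR : ∀ X ∈ R.centralizer, star X ∈ R.centralizer)
    (hZ : ∀ X ∈ (R ∪ {K}).centralizer, star X ∈ (R ∪ {K}).centralizer) {T : H →L[ℂ] H}
    (hT : T ∈ C) :
    Commute T (bicommutantSpan R (closure (Set.range K))).starProjection := by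
  have hPZ := starProjection_bicommutantSpan_range_mem_centralizer hR hK.1.isSelfAdjoint
  have hcomm {a x : H →L[ℂ] H} (ha : a ∈ C) (hx : x ∈ C) :=
    hC.commutator_mul_starProjection ha hx
  have hP := (bicommutantSpan R (closure (Set.range K))).isIdempotentElem_starProjection
  have hPs : star (bicommutantSpan R (closure (Set.range K))).starProjection =
    (bicommutantSpan R (closure (Set.range K))).starProjection := isSelfAdjoint_starProjection _
  generalize (bicommutantSpan R (closure (Set.range K))).starProjection = P at *
  have hcorner : ∀ T ∈ C, P * T * P = T * P := by
    intro T hT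
    have hWC : (1 - P) * T * P ∈ C := by
      have hPT := hC.mul_sub_mul_mem hZ hPZ hT
      have h := C.smul_mem (sub_mem (hC.mul_sub_mul_mem hZ hPZ hPT) hPT) (1 / 2 : ℂ)
      convert h using 1
      simp only [mul_sub, sub_mul, ← mul_assoc, hP.eq, one_mul]
      simp only [mul_assoc, hP.eq]
      module
    have hWP : star ((1 - P) * T * P) * P = 0 := by
      simp only [star_mul, star_sub, star_one, hPs, mul_assoc, hP.one_sub_mul_self, mul_zero]
    have hWW : star ((1 - P) * T * P) * ((1 - P) * T * P) = 0 := by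
      have h := hcomm (star_mem hWC) hWC
      rwa [mul_assoc _ (star _) P, hWP, mul_zero, mul_assoc, mul_assoc _ P, hP.eq] at h
    have hW := (CStarRing.star_mul_self_eq_zero_iff _).1 hWW
    rw [sub_mul, sub_mul, one_mul, sub_eq_zero] at hW
    exact hW.symm
  have h := congr(star $(hcorner _ (star_mem hT)))
  simp only [star_mul, star_star, hPs] at h
  exact (hcorner T hT).symm.trans ((mul_assoc _ _ _).trans h)

theorem IsRBeable.mul_starProjection_mem_centralizer (hC : IsRBeable R (normalState K hK) C)
    (hR : ∀ X ∈ R.centralizer, star X ∈ R.centralizer) {T : H →L[ℂ] H} (hT : T ∈ C) :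
    T * (bicommutantSpan R (closure (Set.range K))).starProjection ∈ R.centralizer := by
  intro A hA
  rw [← mul_assoc, hC.commutator_mul_starProjection (hC.priv hA) hT, mul_assoc,
    starProjection_bicommutantSpan_mem_centralizer hR A hA, mul_assoc]

theorem IsRBeable.mul_starProjection_mem_bicommutant (hC : IsRBeable R (normalState K hK) C)
    (hR : ∀ X ∈ R.centralizer, star X ∈ R.centralizer)
    (hZ : ∀ X ∈ (R ∪ {K}).centralizer, star X ∈ (R ∪ {K}).centralizer) {T : H →L[ℂ] H}
    (hT : T ∈ C) :
    T * (bicommutantSpan R (closure (Set.range K))).starProjection ∈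
      (R ∪ {K}).centralizer.centralizer := by
  have hcomm {a x : H →L[ℂ] H} (ha : a ∈ C) (hx : x ∈ C) :=
    hC.commutator_mul_starProjection ha hx
  have hPZ := starProjection_bicommutantSpan_range_mem_bicommutant hZ
  have hP := (bicommutantSpan R (closure (Set.range K))).isIdempotentElem_starProjection
  have hTP : ∀ T ∈ C, Commute T _ := fun T hT => hC.commute_starProjection hR hZ hT
  have hPs : star (bicommutantSpan R (closure (Set.range K))).starProjection =
    (bicommutantSpan R (closure (Set.range K))).starProjection := isSelfAdjoint_starProjection _
  generalize (bicommutantSpan R (closure (Set.range K))).starProjection = P at *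
  have hprod {a d : H →L[ℂ] H} (hd : d ∈ C) : a * P * (d * P) = a * d * P := by
    rw [mul_assoc, ← mul_assoc P, ← (hTP d hd).eq, mul_assoc d, hP.eq, mul_assoc]
  have hstar : ∀ b ∈ (R ∪ {K}).centralizer,
      Commute (star (T * P)) (T * P * b - b * (T * P)) := by
    intro b hb
    have hD := neg_mem (hC.mul_sub_mul_mem hZ hb hT)
    have hDP : T * P * b - b * (T * P) = -(b * T - T * b) * P := by
      rw [mul_assoc T, ← hPZ b hb]
      noncomm_ring
    rw [hDP, star_mul, hPs, ← (hTP _ (star_mem hT)).eq, commute_iff_eq, hprod hD,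
      hprod (star_mem hT), hcomm (star_mem hT) hD]
  intro b hb
  exact (commute_of_commute_star_commutator (hstar b hb) (hstar _ (hZ b hb))
    (hstar _ (Set.mul_mem_centralizer (hZ b hb) hb))).symm.eq

end UpperBound

section RadonNikodym

variable {H : Type*} [NormedAddCommGroup H] [InnerProductSpace ℂ H] [CompleteSpace H]

theorem norm_apply_eq_of_star_mul_self_eq {X Y : H →L[ℂ] H} (h : star X * X = star Y * Y)
    (v : H) : ‖X v‖ = ‖Y v‖ := by
  have hsq : ‖X v‖ ^ 2 = ‖Y v‖ ^ 2 := by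
    rw [X.apply_norm_sq_eq_inner_adjoint_left, Y.apply_norm_sq_eq_inner_adjoint_left]
    exact congr(RCLike.re ⟪$h v, v⟫_ℂ)
  exact (sq_eq_sq₀ (norm_nonneg _) (norm_nonneg _)).1 hsq

theorem norm_apply_apply_le_of_commute {T X : H →L[ℂ] H} (h : Commute (star X * X) T) (v : H) :
    ‖X (T v)‖ ≤ ‖T‖ * ‖X v‖ := by
  have habs : ∀ w, ‖X w‖ = ‖CFC.abs X w‖ := norm_apply_eq_of_star_mul_self_eq <| by
    rw [(IsSelfAdjoint.of_nonneg (CFC.abs_nonneg X)).star_eq, CFC.abs_mul_abs]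
  have hT : CFC.abs X * T = T * CFC.abs X := h.cfcₙ_nnreal _
  calc ‖X (T v)‖ = ‖CFC.abs X (T v)‖ := habs _
    _ = ‖T (CFC.abs X v)‖ := congr(‖$hT v‖)
    _ ≤ ‖T‖ * ‖X v‖ := by rw [habs v]; exact T.le_opNorm _

theorem exists_continuousLinearMap_apply_eq_of_norm_le {E : Type*} [AddCommGroup E] [Module ℂ E]
    {e f : E →ₗ[ℂ] H} {c : ℝ} (h : ∀ z, ‖f z‖ ≤ c * ‖e z‖) :
    ∃ A : H →L[ℂ] H, (∀ z, A (e z) = f z) ∧ A * e.range.topologicalClosure.starProjection = A := by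
  let e' : E →ₗ[ℂ] e.range.topologicalClosure :=
    e.codRestrict _ fun z => Submodule.le_topologicalClosure _ ⟨z, rfl⟩
  have hdense : DenseRange e' := by
    refine Topology.IsInducing.subtypeVal.dense_iff.2 fun x => ?_
    rw [← Set.range_comp]
    exact x.2
  refine ⟨f.extendOfNorm e' ∘L e.range.topologicalClosure.orthogonalProjectionOnto,
    fun z => ?_, ?_⟩
  · have hez : e.range.topologicalClosure.orthogonalProjectionOnto (e z) = e' z :=
      Submodule.orthogonalProjectionOnto_mem_subspace_eq_self (e' z)
    rw [ContinuousLinearMap.comp_apply, hez, LinearMap.extendOfNorm_eq hdense ⟨c, h⟩]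
  · ext x
    exact congrArg (f.extendOfNorm e')
      (Submodule.orthogonalProjectionOnto_mem_subspace_eq_self _)

theorem exists_mem_centralizer_apply_eq_of_norm_le {N : StarSubalgebra ℂ (H →L[ℂ] H)} {v w : H}
    {c : ℝ} (h : ∀ X ∈ N, ‖X w‖ ≤ c * ‖X v‖) :
    ∃ A ∈ (N : Set (H →L[ℂ] H)).centralizer, A v = w := by
  let orbit (x : H) : N →ₗ[ℂ] H :=
    ContinuousLinearMap.apply ℂ H x ∘ₗ (N.subtype : N →ₐ[ℂ] H →L[ℂ] H).toLinearMap
  let V := (orbit v).range.topologicalClosure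
  obtain ⟨A, hA, hAV⟩ := exists_continuousLinearMap_apply_eq_of_norm_le
    (e := orbit v) (f := orbit w) fun X => h X X.2
  have hV : ∀ X ∈ N, ∀ x ∈ V, X x ∈ V := by
    intro X hX
    have hrange : Set.MapsTo X (orbit v).range (orbit v).range := by
      rintro _ ⟨Y, rfl⟩
      exact ⟨⟨X, hX⟩ * Y, rfl⟩
    exact fun x hx => hrange.closure X.continuous hx
  refine ⟨A, fun X hX => ?_, hA 1⟩
  have hPX : Commute X V.starProjection :=
    commute_starProjection_iff.2 ⟨hV X hX, hV _ (star_mem hX)⟩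
  have hXA : ∀ x ∈ V, X (A x) = A (X x) := by
    refine fun x hx => Set.EqOn.closure (f := X ∘ A) (g := A ∘ X) ?_
      (X.continuous.comp A.continuous) (A.continuous.comp X.continuous) hx
    rintro _ ⟨Y, rfl⟩
    exact congr(X $(hA Y)).trans (hA (⟨X, hX⟩ * Y)).symm
  rw [← hAV, mul_assoc, ← hPX.eq, ← mul_assoc, ← mul_assoc]
  ext x
  exact hXA _ (Submodule.starProjection_apply_mem _ x)

end RadonNikodym

section CyclicSubspace

variable {H : Type*} [NormedAddCommGroup H] [InnerProductSpace ℂ H]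
  {R : Set (H →L[ℂ] H)} {v : H}

theorem eqOn_bicommutantSpan {M : Set H} {X Y : H →L[ℂ] H} (hX : X ∈ R.centralizer)
    (hY : Y ∈ R.centralizer) (h : Set.EqOn X Y M) : Set.EqOn X Y (bicommutantSpan R M) := by
  refine fun x hx => bicommutantSpan_le_of_forall (V := (X : H →ₗ[ℂ] H).eqLocus Y)
    (isClosed_eq X.continuous Y.continuous) (fun A hA x hx => ?_) hx
  calc X (A x) = A (X x) := congr($(hA X hX) x)
    _ = A (Y x) := by rw [h hx]
    _ = Y (A x) := congr($((hA Y hY).symm) x)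

theorem coe_bicommutantSpan_singleton :
    (bicommutantSpan R {v} : Set H) =
      closure ((fun A : H →L[ℂ] H => A v) '' R.centralizer.centralizer) := by
  let V := (Subalgebra.centralizer ℂ R.centralizer).toSubmodule.map
    (ContinuousLinearMap.apply ℂ H v : (H →L[ℂ] H) →ₗ[ℂ] H)
  have hV : {y | ∃ A ∈ R.centralizer.centralizer, ∃ x ∈ ({v} : Set H), y = A x} = V := by
    ext y
    simp [V, eq_comm]
  rw [bicommutantSpan, hV, Submodule.span_eq, Submodule.topologicalClosure_coe]
  rfl

variable [CompleteSpace H]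

theorem tendsto_star_apply_of_isStarNormal {ι : Type*} {l : Filter ι} {A : ι → H →L[ℂ] H}
    {X : H →L[ℂ] H} (hA : ∀ i, IsStarNormal (A i - X))
    (h : Filter.Tendsto (fun i => A i v) l (nhds (X v))) :
    Filter.Tendsto (fun i => star (A i) v) l (nhds (star X v)) := by
  rw [tendsto_iff_norm_sub_tendsto_zero] at h ⊢
  refine h.congr fun i => ?_
  have hi := ContinuousLinearMap.isStarNormal_iff_norm_eq_adjoint.1 (hA i) v
  rwa [← ContinuousLinearMap.star_eq_adjoint, star_sub] at hi

variable (hR : ∀ X ∈ R.centralizer, star X ∈ R.centralizer)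
  (hRcomm : ∀ A ∈ R, ∀ B ∈ R, Commute A B) {X T : H →L[ℂ] H}

include hR hRcomm

theorem exists_tendsto_apply_and_star_apply (hX : X ∈ R.centralizer) (hXsa : IsSelfAdjoint X)
    (hXv : X v ∈ bicommutantSpan R {v}) :
    ∃ A : ℕ → H →L[ℂ] H, (∀ n, A n ∈ R.centralizer.centralizer) ∧
      Filter.Tendsto (fun n => A n v) Filter.atTop (nhds (X v)) ∧
      Filter.Tendsto (fun n => star (A n) v) Filter.atTop (nhds (X v)) := by
  rw [← SetLike.mem_coe, coe_bicommutantSpan_singleton, mem_closure_iff_seq_limit] at hXv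
  obtain ⟨y, hy, hlim⟩ := hXv
  choose A hA hAy using hy
  obtain rfl : (fun n => A n v) = y := funext hAy
  refine ⟨A, hA, hlim, ?_⟩
  rw [← hXsa.star_eq]
  refine tendsto_star_apply_of_isStarNormal (fun n => ⟨?_⟩) hlim
  have hA' := Set.star_mem_centralizer' hR (hA n)
  have hAA : Commute (star (A n)) (A n) :=
    Set.centralizer_centralizer_comm_of_comm hRcomm _ hA' _ (hA n)
  have hXA : Commute X (A n) := hA n X hX
  have hXA' : Commute X (star (A n)) := hA' X hX
  rw [star_sub, hXsa.star_eq]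
  exact (hAA.sub_right hXA'.symm).sub_left (hXA.sub_right (Commute.refl X))

theorem inner_apply_apply_eq_of_mem_bicommutant (hX : X ∈ R.centralizer)
    (hXsa : IsSelfAdjoint X) (hXv : X v ∈ bicommutantSpan R {v}) (hT : T ∈ R.centralizer)
    {B : H →L[ℂ] H} (hB : B ∈ R.centralizer.centralizer) :
    ⟪T (X v), B v⟫_ℂ = ⟪X (T v), B v⟫_ℂ := by
  obtain ⟨A, hA, hlim, hlim'⟩ := exists_tendsto_apply_and_star_apply hR hRcomm hX hXsa hXv
  have hleft : Filter.Tendsto (fun n => ⟪T (A n v), B v⟫_ℂ) Filter.atTop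
      (nhds ⟪T (X v), B v⟫_ℂ) :=
    ((T.continuous.tendsto _).comp hlim).inner tendsto_const_nhds
  have hright : Filter.Tendsto (fun n => ⟪T v, B (star (A n) v)⟫_ℂ) Filter.atTop
      (nhds ⟪T v, B (X v)⟫_ℂ) :=
    tendsto_const_nhds.inner ((B.continuous.tendsto _).comp hlim')
  have heq (n : ℕ) : ⟪T (A n v), B v⟫_ℂ = ⟪T v, B (star (A n) v)⟫_ℂ := by
    have hAB := Set.centralizer_centralizer_comm_of_comm hRcomm _ hB _
      (Set.star_mem_centralizer' hR (hA n))
    rw [show T (A n v) = A n (T v) from congr($(hA n T hT) v),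
      show B (star (A n) v) = star (A n) (B v) from congr($hAB v),
      ContinuousLinearMap.star_eq_adjoint, ContinuousLinearMap.adjoint_inner_right]
  calc ⟪T (X v), B v⟫_ℂ = ⟪T v, B (X v)⟫_ℂ :=
        tendsto_nhds_unique (hleft.congr heq) hright
    _ = ⟪T v, X (B v)⟫_ℂ := congr(⟪T v, $((hB X hX).symm) v⟫_ℂ)
    _ = ⟪X (T v), B v⟫_ℂ := (hXsa.isSymmetric _ _).symm

theorem apply_apply_comm_of_mem_centralizer (hX : X ∈ R.centralizer) (hXsa : IsSelfAdjoint X)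
    (hXS : ∀ x ∈ bicommutantSpan R {v}, X x ∈ bicommutantSpan R {v}) (hT : T ∈ R.centralizer)
    (hTS : ∀ x ∈ bicommutantSpan R {v}, T x ∈ bicommutantSpan R {v}) :
    ∀ x ∈ bicommutantSpan R {v}, X (T x) = T (X x) := by
  have hv : v ∈ bicommutantSpan R {v} := subset_bicommutantSpan rfl
  let z := X (T v) - T (X v)
  have horth : bicommutantSpan R {v} ≤ (Submodule.span ℂ {z})ᗮ := by
    refine bicommutantSpan_le_of_forall (Submodule.isClosed_orthogonal _) ?_
    rintro B hB _ rfl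
    rw [Submodule.mem_orthogonal_singleton_iff_inner_right, inner_sub_left, sub_eq_zero,
      inner_apply_apply_eq_of_mem_bicommutant hR hRcomm hX hXsa (hXS _ hv) hT hB]
  have hz : z ∈ bicommutantSpan R {v} := sub_mem (hXS _ (hTS _ hv)) (hTS _ (hXS _ hv))
  have hXTv : X (T v) = T (X v) := sub_eq_zero.1 <| inner_self_eq_zero.1 <|
    Submodule.mem_orthogonal_singleton_iff_inner_right.1 (horth hz)
  refine eqOn_bicommutantSpan (Set.mul_mem_centralizer hX hT) (Set.mul_mem_centralizer hT hX) ?_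
  rintro _ rfl
  exact hXTv

theorem commute_mul_mul_starProjection_of_cyclic (hX : X ∈ R.centralizer)
    (hT : T ∈ R.centralizer) (hTP : Commute T (bicommutantSpan R {v}).starProjection) :
    Commute (star (X * (bicommutantSpan R {v}).starProjection) *
      (X * (bicommutantSpan R {v}).starProjection)) T := by
  set P := (bicommutantSpan R {v}).starProjection
  have hPP : P * P = P := Submodule.isIdempotentElem_starProjection _
  have hPsa : star P = P := isSelfAdjoint_starProjection _
  have hP : P ∈ R.centralizer := starProjection_bicommutantSpan_mem_centralizer hR
  have hZ : star (X * P) * (X * P) ∈ R.centralizer :=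
    Set.mul_mem_centralizer (hR _ (Set.mul_mem_centralizer hX hP)) (Set.mul_mem_centralizer hX hP)
  set Z := star (X * P) * (X * P) with hZ_def
  have hZP : Z * P = Z := by simp only [hZ_def, mul_assoc, hPP]
  have hPZ : P * Z = Z := by
    rw [hZ_def, star_mul, hPsa, ← mul_assoc, ← mul_assoc P, hPP]
  have hZTP : Z * T * P = T * Z * P := by
    ext x
    exact apply_apply_comm_of_mem_centralizer hR hRcomm hZ (IsSelfAdjoint.star_mul_self _)
      (commute_starProjection_iff.1 (hZP.trans hPZ.symm)).1 hT
      (commute_starProjection_iff.1 hTP).1 _ (Submodule.starProjection_apply_mem _ x)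
  calc Z * T = Z * P * T := by rw [hZP]
    _ = Z * T * P := by rw [mul_assoc, ← hTP.eq, ← mul_assoc]
    _ = T * Z := by rw [hZTP, mul_assoc, hZP]

theorem exists_mem_bicommutant_mul_starProjection_eq (hT : T ∈ R.centralizer)
    (hTP : Commute T (bicommutantSpan R {v}).starProjection) :
    ∃ A ∈ R.centralizer.centralizer,
      A * (bicommutantSpan R {v}).starProjection = T * (bicommutantSpan R {v}).starProjection := by
  let P := (bicommutantSpan R {v}).starProjection
  have hv : v ∈ bicommutantSpan R {v} := subset_bicommutantSpan rfl
  have hPv : P v = v := Submodule.starProjection_eq_self_iff.2 hv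
  have hPTv : P (T v) = T v :=
    Submodule.starProjection_eq_self_iff.2 ((commute_starProjection_iff.1 hTP).1 v hv)
  have hle : ∀ X ∈ StarSubalgebra.centralizer ℂ R, ‖X (T v)‖ ≤ ‖T‖ * ‖X v‖ := by
    intro X hX
    rw [← SetLike.mem_coe, coe_starSubalgebra_centralizer hR] at hX
    have h := norm_apply_apply_le_of_commute
      (commute_mul_mul_starProjection_of_cyclic hR hRcomm hX hT hTP) v
    rwa [show (X * P) (T v) = X (T v) from congrArg X hPTv,
      show (X * P) v = X v from congrArg X hPv] at h
  obtain ⟨A, hA, hAv⟩ := exists_mem_centralizer_apply_eq_of_norm_le hle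
  rw [coe_starSubalgebra_centralizer hR] at hA
  have hAR : A ∈ R.centralizer := fun B hB =>
    Set.centralizer_centralizer_comm_of_comm hRcomm _ (Set.subset_centralizer_centralizer hB) _ hA
  refine ⟨A, hA, ?_⟩
  ext x
  refine eqOn_bicommutantSpan hAR hT ?_ (Submodule.starProjection_apply_mem _ x)
  rintro _ rfl
  exact hAv

end CyclicSubspace

section Maximality

variable {H : Type*} [NormedAddCommGroup H] [InnerProductSpace ℂ H] [CompleteSpace H]
  {R : Set (H →L[ℂ] H)} {K : H →L[ℂ] H}

theorem star_mem_centralizer_union_singleton (hR : ∀ A ∈ R, IsStarNormal A)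
    (hK : IsSelfAdjoint K) : ∀ X ∈ (R ∪ {K}).centralizer, star X ∈ (R ∪ {K}).centralizer := by
  refine star_mem_centralizer_of_isStarNormal ?_
  rintro A (hA | rfl)
  · exact hR A hA
  · exact hK.isStarNormal

theorem image_mul_starProjection_eq {N : Set (H →L[ℂ] H)}
    (hPR : (bicommutantSpan R (closure (Set.range K))).starProjection ∈ R.centralizer)
    (hPZ : (bicommutantSpan R (closure (Set.range K))).starProjection ∈
      (R ∪ {K}).centralizer.centralizer)
    (hNR : N ⊆ R.centralizer) (hNZ : N ⊆ (R ∪ {K}).centralizer.centralizer)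
    (hN : ∀ T ∈ R.centralizer, T ∈ (R ∪ {K}).centralizer.centralizer →
      T * (bicommutantSpan R (closure (Set.range K))).starProjection = T →
      ∃ A ∈ N, A * (bicommutantSpan R (closure (Set.range K))).starProjection = T) :
    (· * (bicommutantSpan R (closure (Set.range K))).starProjection) '' N =
      R.centralizer ∩ (R ∪ {K}).centralizer.centralizer ∩
        {T | T * (bicommutantSpan R (closure (Set.range K))).starProjection = T} := by
  refine Set.Subset.antisymm ?_ fun T hT => hN T hT.1.1 hT.1.2 hT.2
  rintro _ ⟨A, hA, rfl⟩
  refine ⟨⟨Set.mul_mem_centralizer (hNR hA) hPR, Set.mul_mem_centralizer (hNZ hA) hPZ⟩, ?_⟩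
  exact (mul_assoc _ _ _).trans
    congr(A * $((bicommutantSpan R (closure (Set.range K))).isIdempotentElem_starProjection.eq))

theorem exists_isGreatest_isRBeable (hR : ∀ A ∈ R, IsStarNormal A) (hK : IsDensityOperator K)
    {N : StarSubalgebra ℂ (H →L[ℂ] H)} (hRN : R ⊆ N)
    (hNZ : (N : Set (H →L[ℂ] H)) ⊆ (R ∪ {K}).centralizer.centralizer)
    (hcomm : ∀ A ∈ N, ∀ B ∈ N, Commute A B)
    (hN : ∀ T ∈ R.centralizer, T ∈ (R ∪ {K}).centralizer.centralizer →
      T * (bicommutantSpan R (closure (Set.range K))).starProjection = T →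
      ∃ A ∈ N, A * (bicommutantSpan R (closure (Set.range K))).starProjection = T) :
    ∃ B : StarSubalgebra ℂ (H →L[ℂ] H),
      (B : Set (H →L[ℂ] H)) = orthogonalSum (bicommutantSpan R (closure (Set.range K))) N ∧
      IsGreatest {C | IsRBeable R (normalState K hK) C} B := by
  have hR' := star_mem_centralizer_of_isStarNormal hR
  have hZ' := star_mem_centralizer_union_singleton hR hK.1.isSelfAdjoint
  have hPR := starProjection_bicommutantSpan_mem_centralizer (M := closure (Set.range K)) hR'
  have hPZ' := starProjection_bicommutantSpan_range_mem_centralizer hR' hK.1.isSelfAdjoint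
  have hPZ := starProjection_bicommutantSpan_range_mem_bicommutant hZ'
  have hNP := fun A hA => Commute.symm (hNZ (a := A) hA _ hPZ')
  have himage := image_mul_starProjection_eq hPR hPZ
    (fun A hA B hB => hcomm B (hRN hB) A hA) hNZ hN
  have hcl : IsClosed ((· * (bicommutantSpan R (closure (Set.range K))).starProjection) ''
      (N : Set (H →L[ℂ] H))) := by
    rw [himage]
    exact ((Set.isClosed_centralizer _).inter (Set.isClosed_centralizer _)).inter
      (isClosed_eq (by fun_prop) continuous_id)
  refine ⟨orthogonalSumSubalgebra _ N hNP, rfl, isRBeable_orthogonalSumSubalgebra hK hZ' hNP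
    (mul_starProjection_bicommutantSpan_self hK.1.isSelfAdjoint) hPZ hRN hNZ hcomm hcl, ?_⟩
  intro C hC T hT
  obtain ⟨A, hA, hAT⟩ := hN _ (hC.mul_starProjection_mem_centralizer hR' hT)
    (hC.mul_starProjection_mem_bicommutant hR' hZ' hT)
    (by rw [mul_assoc, Submodule.isIdempotentElem_starProjection _])
  exact (mem_orthogonalSum_iff hNP).2
    ⟨hC.commute_starProjection hR' hZ' hT, A, hA, hAT.symm⟩

theorem isMaximalRBeable_iff_of_isGreatest {A : Type*} [CStarAlgebra A] {R : Set A}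
    {ρ : stateSpace A} {B C : StarSubalgebra ℂ A} (hB : IsGreatest {C | IsRBeable R ρ C} B) :
    IsMaximalRBeable R ρ C ↔ C = B :=
  hB.maximal_iff

theorem exists_isGreatest_isRBeable_of_mem_centralizer (hR : ∀ A ∈ R, IsStarNormal A)
    (hRcomm : ∀ A ∈ R, ∀ B ∈ R, Commute A B) (hK : IsDensityOperator K)
    (hKR : K ∈ R.centralizer) :
    ∃ B : StarSubalgebra ℂ (H →L[ℂ] H),
      (B : Set (H →L[ℂ] H)) = orthogonalSum (bicommutantSpan R (closure (Set.range K)))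
        (vonNeumannGenerated (R ∪ {K})) ∧
      IsGreatest {C | IsRBeable R (normalState K hK) C} B := by
  have hZ' := star_mem_centralizer_union_singleton hR hK.1.isSelfAdjoint
  have hN : (StarSubalgebra.centralizer ℂ (R ∪ {K}).centralizer : Set (H →L[ℂ] H)) =
      (R ∪ {K}).centralizer.centralizer :=
    coe_starSubalgebra_centralizer fun X hX => Set.star_mem_centralizer' hZ' hX
  have hZcomm : ∀ A ∈ R ∪ {K}, ∀ B ∈ R ∪ {K}, A * B = B * A := by
    rintro A (hA | rfl) B (hB | rfl)
    exacts [hRcomm A hA B hB, hKR A hA, (hKR B hB).symm, rfl]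
  rw [(vonNeumannGenerated_eq_centralizer_centralizer hZ').trans hN.symm]
  refine exists_isGreatest_isRBeable hR hK ?_ hN.le (fun A hA B hB => ?_) fun T _ hT hTP =>
    ⟨T, hN.ge hT, hTP⟩
  · exact (Set.subset_union_left.trans Set.subset_centralizer_centralizer).trans hN.ge
  · exact Set.centralizer_centralizer_comm_of_comm hZcomm _ (hN.le hA) _ (hN.le hB)

theorem exists_isGreatest_isRBeable_of_eq_starProjection (hR : ∀ A ∈ R, IsStarNormal A)
    (hRcomm : ∀ A ∈ R, ∀ B ∈ R, Commute A B) (hK : IsDensityOperator K) {v : H}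
    (hKv : K = (Submodule.span ℂ {v}).starProjection) :
    ∃ B : StarSubalgebra ℂ (H →L[ℂ] H),
      (B : Set (H →L[ℂ] H)) = orthogonalSum (bicommutantSpan R {v}) (vonNeumannGenerated R) ∧
      IsGreatest {C | IsRBeable R (normalState K hK) C} B := by
  have hR' := star_mem_centralizer_of_isStarNormal hR
  have hN : (StarSubalgebra.centralizer ℂ R.centralizer : Set (H →L[ℂ] H)) =
      R.centralizer.centralizer :=
    coe_starSubalgebra_centralizer fun X hX => Set.star_mem_centralizer' hR' hX
  have hS : bicommutantSpan R (closure (Set.range K)) = bicommutantSpan R {v} := by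
    rw [← bicommutantSpan_closure_span (M := {v}), hKv]
    congr 2
    exact congrArg SetLike.coe (Submodule.range_starProjection _)
  have hP : (bicommutantSpan R (closure (Set.range K))).starProjection =
      (bicommutantSpan R {v}).starProjection := Submodule.starProjection_inj.2 hS
  have hPZ := starProjection_bicommutantSpan_range_mem_centralizer hR' hK.1.isSelfAdjoint
  have hsum : orthogonalSum (bicommutantSpan R {v}) (vonNeumannGenerated R) = orthogonalSum
      (bicommutantSpan R (closure (Set.range K))) (StarSubalgebra.centralizer ℂ R.centralizer) := by
    rw [(vonNeumannGenerated_eq_centralizer_centralizer hR').trans hN.symm]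
    simp only [orthogonalSum, hP]
  rw [hsum]
  refine exists_isGreatest_isRBeable hR hK ?_ ?_ (fun A hA B hB => ?_) fun T hTR hTZ hTP => ?_
  · exact Set.subset_centralizer_centralizer.trans hN.ge
  · exact hN.le.trans (Set.centralizer_subset (Set.centralizer_subset Set.subset_union_left))
  · exact Set.centralizer_centralizer_comm_of_comm hRcomm _ (hN.le hA) _ (hN.le hB)
  · have hTP' := hTZ _ hPZ
    rw [hP] at hTP hTP' ⊢
    obtain ⟨A, hA, hAT⟩ := exists_mem_bicommutant_mul_starProjection_eq hR' hRcomm hTR hTP'.symm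
    exact ⟨A, hN.ge hA, hAT.trans hTP⟩

end Maximality

theorem mainTheorem4_general {H : Type*} [NormedAddCommGroup H] [InnerProductSpace ℂ H]
    [CompleteSpace H]
    (R : Set (H →L[ℂ] H)) (hR : ∀ A ∈ R, IsStarNormal A)
    (hRcomm : ∀ A ∈ R, ∀ B ∈ R, Commute A B)
    (K : H →L[ℂ] H) (hK : IsDensityOperator K) :
    (K ∈ Set.centralizer R →
      ∃ B : StarSubalgebra ℂ (H →L[ℂ] H),
        (B : Set (H →L[ℂ] H)) =
          orthogonalSum (bicommutantSpan R (closure (Set.range K)))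
            (vonNeumannGenerated (R ∪ {K})) ∧
        ∀ C : StarSubalgebra ℂ (H →L[ℂ] H),
          IsMaximalRBeable R (normalState K hK) C ↔ C = B) ∧
    (∀ v : H, K = (Submodule.span ℂ {v}).starProjection →
      ∃ B : StarSubalgebra ℂ (H →L[ℂ] H),
        (B : Set (H →L[ℂ] H)) =
          orthogonalSum (bicommutantSpan R {v}) (vonNeumannGenerated R) ∧
        ∀ C : StarSubalgebra ℂ (H →L[ℂ] H),
          IsMaximalRBeable R (normalState K hK) C ↔ C = B) := by
  refine ⟨fun hKR => ?_, fun v hv => ?_⟩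
  · obtain ⟨B, hB, hgreatest⟩ := exists_isGreatest_isRBeable_of_mem_centralizer hR hRcomm hK hKR
    exact ⟨B, hB, fun _ => isMaximalRBeable_iff_of_isGreatest hgreatest⟩
  · obtain ⟨B, hB, hgreatest⟩ :=
      exists_isGreatest_isRBeable_of_eq_starProjection hR hRcomm hK hv
    exact ⟨B, hB, fun _ => isMaximalRBeable_iff_of_isGreatest hgreatest⟩

theorem mainTheorem4 {H : Type*} [NormedAddCommGroup H] [InnerProductSpace ℂ H] [CompleteSpace H]
    (R : Set (H →L[ℂ] H)) (hRsa : ∀ A ∈ R, IsSelfAdjoint A)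
    (hRcomm : ∀ A ∈ R, ∀ B ∈ R, Commute A B)
    (K : H →L[ℂ] H) (hK : IsDensityOperator K) :
    (K ∈ Set.centralizer R →
      ∃ B : StarSubalgebra ℂ (H →L[ℂ] H),
        (B : Set (H →L[ℂ] H)) =
          orthogonalSum (bicommutantSpan R (closure (Set.range K)))
            (vonNeumannGenerated (R ∪ {K})) ∧
        ∀ C : StarSubalgebra ℂ (H →L[ℂ] H),
          IsMaximalRBeable R (normalState K hK) C ↔ C = B) ∧
    (∀ v : H, K = (Submodule.span ℂ {v}).starProjection →
      ∃ B : StarSubalgebra ℂ (H →L[ℂ] H),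
        (B : Set (H →L[ℂ] H)) =
          orthogonalSum (bicommutantSpan R {v}) (vonNeumannGenerated R) ∧
        ∀ C : StarSubalgebra ℂ (H →L[ℂ] H),
          IsMaximalRBeable R (normalState K hK) C ↔ C = B) :=
  mainTheorem4_general R (fun A hA => (hRsa A hA).isStarNormal) hRcomm K hK
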